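/- For each $n\ge 1$ let $A_n$ be an $n\times n$ Hermitian matrix, and suppose that the spectral norms are uniformly bounded, $\sup_n\|A_n\|<\infty$. Let $\mu_n=\frac1n\sum_{i=1}^n\delta_{\lambda_i(A_n)}$ be the empirical spectral distribution of $A_n$ (eigenvalues counted with multiplicity), and let $\mu$ be a Borel probability measure on $\mathbb R$ whose absolutely continuous part (in its Lebesgue decomposition) is nonzero. Suppose that $$\mathrm{Kol}(\mu_n,\mu):=\sup_{t\in\mathbb R}\bigl|\mu_n((-\infty,t])-\mu((-\infty,t])\bigr|=O(1/\log n)\qquad(n\to\infty).$$ For a unit vector $u$ run the Lanczos algorithm on $A_n$: $v_0=u$ and, for $j=0,1,2,\dots$, $W_j=\mathrm{span}\{v_0,\dots,v_j\}$, $\alpha_j=\langle A_nv_j,v_j\rangle$, $\beta_j=\|\mathrm{Proj}_{W_j^\perp}(A_nv_j)\|$, and $v_{j+1}=\mathrm{Proj}_{W_j^\perp}(A_nv_j)/\beta_j$, the algorithm stopping if $\beta_j=0$. Its output after $k$ iterations is the $k\times k$ symmetric tridiagonal (Jacobi) matrix $J_k(u)$ with diagonal entries $\alpha_0,\dots,\alpha_{k-1}$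 and off-diagonal entries $\beta_0,\dots,\beta_{k-2}$ (missing coefficients are set to $0$ if the algorithm stops early). For each $n$ let $u_n$ be uniformly distributed on the unit sphere $\mathbb S^{n-1}$ of $\mathbb R^n\subset\mathbb C^n$. Then there exist $c_2>0$ and integers $k_n$ with $1\le k_n\le n$ and $k_n\ge c_2\log n$ for all $n\ge1$ such that, as $n\to\infty$, the Jacobi matrices $J_{k_n}(u_n)$ output by the Lanczos algorithm applied to $A_n$ converge entrywise in probability to deterministic constants, in the following sense: 1. the probability that the algorithm stops before completing $k_n$ iterations (that is, $\beta_j=0$ for some $j<k_n-1$) tends to $0$; 2. there are deterministic $k_n\times k_n$ real matrices $C_n$ such that for every $\varepsilon>0$ $$\mathbf P\Bigl[\max_{1\le i,j\le k_n}\bigl|J_{k_n}(u_n)_{ij}-(C_n)_{ij}\bigr|\ge\varepsilon\Bigr]\longrightarrow0;$$ 3. there are real constants $L_{ij}$ $(i,j\ge1)$, not depending on $n$, such that for every fixed $i,j$ the entries $J_{k_n}(u_n)_{ij}$ (defined once $k_n\ge\max(i,j)$) converge to $L_{ij}$ in probability. -/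

import Mathlib

open MeasureTheory Filter Topology Asymptotics

noncomputable section

/-- Kolmogorov distance `sup_t |μ((-∞, t]) - ν((-∞, t])|` of two measures on the line
(used for probability measures, where the supremum is over a bounded set). -/
def kolmogorovDist (μ ν : Measure ℝ) : ℝ :=
  ⨆ t : ℝ, |μ.real (Set.Iic t) - ν.real (Set.Iic t)|

/-- Empirical spectral distribution `(1/n) ∑ δ_{λ_i}` of an `n × n` Hermitian matrix, where the
eigenvalues `λ_i` are listed with multiplicity. -/
def empiricalSpectralDist {n : ℕ} {A : Matrix (Fin n) (Fin n) ℂ} (hA : A.IsHermitian) :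
    Measure ℝ :=
  (n : ENNReal)⁻¹ • ∑ i, Measure.dirac (hA.eigenvalues i)

/-- The uniform probability measure on the unit sphere of `ℝⁿ` (`n ≥ 1`): the normalized surface
measure. -/
def sphereUnif (n : ℕ) : Measure (Metric.sphere (0 : EuclideanSpace ℝ (Fin n)) 1) :=
  ((volume : Measure (EuclideanSpace ℝ (Fin n))).toSphere Set.univ)⁻¹ •
    (volume : Measure (EuclideanSpace ℝ (Fin n))).toSphere

/-- A real vector regarded as a complex vector. -/
def complexify {n : ℕ} (u : EuclideanSpace ℝ (Fin n)) : EuclideanSpace ℂ (Fin n) :=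
  WithLp.toLp 2 fun i => (u i : ℂ)

section Lanczos

variable {n : ℕ} (A : Matrix (Fin n) (Fin n) ℂ) (u : EuclideanSpace ℂ (Fin n))

/-- The Lanczos vectors: `v₀ = u`, and `v_{j+1}` is the normalization of the orthogonal projection
of `A v_j` onto the complement of `W_j = span {v₀, …, v_j}`. If that projection vanishes (the
algorithm stops), all later vectors are `0`. -/
def lanczosVec : ℕ → EuclideanSpace ℂ (Fin n)
  | 0 => u
  | j + 1 =>
    let W : Submodule ℂ (EuclideanSpace ℂ (Fin n)) :=
      Submodule.span ℂ (Set.range fun l : Fin (j + 1) => lanczosVec l.1)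
    let w := Wᗮ.starProjection (Matrix.toEuclideanCLM (𝕜 := ℂ) A (lanczosVec j))
    ((‖w‖⁻¹ : ℝ) : ℂ) • w
  termination_by j => j
  decreasing_by all_goals omega

/-- `W_j = span {v₀, …, v_j}`. -/
def lanczosSpace (j : ℕ) : Submodule ℂ (EuclideanSpace ℂ (Fin n)) :=
  Submodule.span ℂ (Set.range fun l : Fin (j + 1) => lanczosVec A u l.1)

/-- `α_j = ⟨A v_j, v_j⟩`, a real number for Hermitian `A`. -/
def lanczosAlpha (j : ℕ) : ℝ :=
  (inner ℂ (lanczosVec A u j) (Matrix.toEuclideanCLM (𝕜 := ℂ) A (lanczosVec A u j))).re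

/-- `β_j`, the norm of the projection of `A v_j` onto the complement of `W_j`. -/
def lanczosBeta (j : ℕ) : ℝ :=
  ‖(lanczosSpace A u j)ᗮ.starProjection
    (Matrix.toEuclideanCLM (𝕜 := ℂ) A (lanczosVec A u j))‖

/-- The Lanczos algorithm stops before completing `k` iterations: some `β_j = 0` with `j + 1 < k`,
so that it does not output a full `k × k` matrix. -/
def LanczosStopsBefore (k : ℕ) : Prop :=
  ∃ j : ℕ, j + 1 < k ∧ lanczosBeta A u j = 0

/-- The `k × k` Jacobi matrix output by the Lanczos algorithm after `k` iterations: symmetric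
tridiagonal, with diagonal `α₀, …, α_{k-1}` and off-diagonal `β₀, …, β_{k-2}`
(padded by zeros if the algorithm stops early). -/
def lanczosJacobi (k : ℕ) : Matrix (Fin k) (Fin k) ℝ :=
  Matrix.of fun i j =>
    if i = j then lanczosAlpha A u i
    else if (i : ℕ) + 1 = j then lanczosBeta A u i
    else if (j : ℕ) + 1 = i then lanczosBeta A u j
    else 0

end Lanczos

end

/-!
The Lanczos vectors of `A` started at a unit vector `u` are the vectors `p_j(A) u`, where `p_j` are
the orthonormal polynomials of the functional `p ↦ ⟨u, p(A) u⟩`, that is, of the spectral measure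
of `A` at `u`; so the Lanczos output is the Jacobi matrix of this functional (`lanczosJacobi_eq`).
For random `u` the functional is close to its mean `p ↦ (1/n) ∑ p(λ_i)`, and the deterministic
matrices `C_n` are the Jacobi matrices of that mean. Comparing with the limit `μ` itself would not
do for part 2, because the moments of `μ_n` and `μ` may differ by a multiple of `1 / log n`, which
is too much for degrees of the order of `log n`.

* Concentration (`sphereUnif_moment_deviation`). A moment `⟨u, A ^ m u⟩` is a real quadratic form
  in `u`, with variance `O(M ^ (2 m) / n)` by the fourth moments of the uniform distribution on the
  sphere. Hence for `k ≈ c log n` with small `c`, the first `2 k + 2` moments are within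
  `n ^ (-1/4)` of their means, outside an event of probability tending to `0`.

* Stability (`IsBddPos.jacobi_stable`). The Jacobi coefficients change little if the perturbation
  of the moments is small compared with an exponential in `k` and with the minimum `κ` of
  `(1/n) ∑ p(λ_i) ^ 2` over monic `p` of degree at most `k`.

* The minimum `κ` is at worst exponentially small in `k` (`le_empFunctional_of_monic`). The set
  `{|p| ≤ δ₀ ^ deg p}` has small Lebesgue measure, since the logarithmic kernel is integrable, so a
  fixed part of the absolutely continuous part of `μ` lives on its complement. It is a union of at
  most `O(k)` intervals, so `μ_n` and `μ` differ on it by `O(k / log n)`, which is small for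
  `k ≈ c log n`. This is where the rate of convergence is used.

For a fixed entry, the same stability estimate, with `k` fixed, applies to two mean functionals and
shows that the entries of `C_n` form a Cauchy sequence (`exists_tendsto_jacobiEntry`).
-/

open Polynomial

/-! ### Orthogonal polynomials of a positive functional -/

/-- A normalized positive linear functional on real polynomials for which multiplication by `X`
has norm at most `M`; the model is integration against a probability measure on `[-M, M]`. -/
structure IsBddPos (L : ℝ[X] →ₗ[ℝ] ℝ) (M : ℝ) : Prop where
  map_one : L 1 = 1
  nonneg : ∀ p, 0 ≤ L (p * p)
  bdd : ∀ p, L (X * p * (X * p)) ≤ M ^ 2 * L (p * p)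

/-- The monic orthogonal polynomials of a functional `L`, by their three-term recurrence. The
recurrence is the right one only as long as `L (P_j ^ 2) ≠ 0`. -/
noncomputable def orthoPoly (L : ℝ[X] →ₗ[ℝ] ℝ) : ℕ → ℝ[X]
  | 0 => 1
  | 1 => X - C (L X / L 1)
  | j + 2 =>
    (X - C (L (X * orthoPoly L (j + 1) * orthoPoly L (j + 1)) /
        L (orthoPoly L (j + 1) * orthoPoly L (j + 1)))) * orthoPoly L (j + 1)
      - C (L (orthoPoly L (j + 1) * orthoPoly L (j + 1)) /
          L (orthoPoly L j * orthoPoly L j)) * orthoPoly L j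

/-- The squared norm `L (P_j ^ 2)` of the `j`-th monic orthogonal polynomial. -/
noncomputable def orthoNormSq (L : ℝ[X] →ₗ[ℝ] ℝ) (j : ℕ) : ℝ :=
  L (orthoPoly L j * orthoPoly L j)

/-- The diagonal Jacobi coefficient `L (X P_j ^ 2) / L (P_j ^ 2)`. -/
noncomputable def jacobiDiag (L : ℝ[X] →ₗ[ℝ] ℝ) (j : ℕ) : ℝ :=
  L (X * orthoPoly L j * orthoPoly L j) / orthoNormSq L j

/-- The square `L (P_{j+1} ^ 2) / L (P_j ^ 2)` of the off-diagonal Jacobi coefficient. -/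
noncomputable def jacobiOffSq (L : ℝ[X] →ₗ[ℝ] ℝ) (j : ℕ) : ℝ :=
  orthoNormSq L (j + 1) / orthoNormSq L j

section Algebra

variable {L L' : ℝ[X] →ₗ[ℝ] ℝ} {M : ℝ}

lemma map_C_mul (L : ℝ[X] →ₗ[ℝ] ℝ) (a : ℝ) (p : ℝ[X]) : L (C a * p) = a * L p := by
  rw [← smul_eq_C_mul, map_smul, smul_eq_mul]

lemma orthoPoly_zero : orthoPoly L 0 = 1 := by simp [orthoPoly]

lemma orthoPoly_succ_zero : X * orthoPoly L 0 = orthoPoly L 1 + C (jacobiDiag L 0) := by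
  simp [orthoPoly, jacobiDiag, orthoNormSq]

lemma orthoPoly_succ_succ (j : ℕ) :
    X * orthoPoly L (j + 1) = orthoPoly L (j + 2) + C (jacobiDiag L (j + 1)) * orthoPoly L (j + 1)
      + C (jacobiOffSq L j) * orthoPoly L j := by
  rw [orthoPoly, jacobiDiag, jacobiOffSq, orthoNormSq, orthoNormSq]; ring

/-- Multiplication by `X` is tridiagonal in the orthogonal polynomials. -/
lemma exists_X_mul_orthoPoly (i : ℕ) : ∃ R : ℝ[X], (i = 0 ∧ R = 0 ∨ ∃ l, i = l + 1 ∧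
      R = C (jacobiOffSq L l) * orthoPoly L l) ∧
    X * orthoPoly L i = orthoPoly L (i + 1) + C (jacobiDiag L i) * orthoPoly L i + R := by
  cases i with
  | zero => exact ⟨0, Or.inl ⟨rfl, rfl⟩, by rw [orthoPoly_succ_zero, orthoPoly_zero]; simp⟩
  | succ l => exact ⟨_, Or.inr ⟨l, rfl, rfl⟩, orthoPoly_succ_succ l⟩

lemma monic_natDegree_orthoPoly (j : ℕ) :
    (orthoPoly L j).Monic ∧ (orthoPoly L j).natDegree = j := by
  induction j using Nat.strong_induction_on with
  | _ j ih =>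
    match j, ih with
    | 0, _ => simp [orthoPoly_zero]
    | 1, _ => simp only [orthoPoly]; exact ⟨monic_X_sub_C _, natDegree_X_sub_C _⟩
    | j + 2, ih =>
      obtain ⟨h1, d1⟩ := ih (j + 1) (by omega)
      obtain ⟨h0, d0⟩ := ih j (by omega)
      rw [orthoPoly]
      have hm := (monic_X_sub_C (L (X * orthoPoly L (j + 1) * orthoPoly L (j + 1)) /
        L (orthoPoly L (j + 1) * orthoPoly L (j + 1)))).mul h1
      have hd : natDegree ((X - C (L (X * orthoPoly L (j + 1) * orthoPoly L (j + 1)) /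
        L (orthoPoly L (j + 1) * orthoPoly L (j + 1)))) * orthoPoly L (j + 1)) = j + 2 := by
        rw [(monic_X_sub_C _).natDegree_mul h1, natDegree_X_sub_C, d1]; omega
      have hlt : degree (C (L (orthoPoly L (j + 1) * orthoPoly L (j + 1)) /
          L (orthoPoly L j * orthoPoly L j)) * orthoPoly L j) <
          degree ((X - C (L (X * orthoPoly L (j + 1) * orthoPoly L (j + 1)) /
        L (orthoPoly L (j + 1) * orthoPoly L (j + 1)))) * orthoPoly L (j + 1)) := by
        rw [degree_eq_natDegree hm.ne_zero, hd]
        refine lt_of_le_of_lt degree_le_natDegree ?_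
        have := natDegree_C_mul_le (L (orthoPoly L (j + 1) * orthoPoly L (j + 1)) /
          L (orthoPoly L j * orthoPoly L j)) (orthoPoly L j)
        exact_mod_cast (by omega)
      refine ⟨hm.sub_of_left hlt, ?_⟩
      rw [natDegree_eq_of_degree_eq (degree_sub_eq_left_of_degree_lt hlt), hd]

/-- Orthogonality, as long as the earlier polynomials have nonzero norm. -/
lemma map_orthoPoly_mul_orthoPoly (j : ℕ) (h : ∀ i < j, orthoNormSq L i ≠ 0) :
    ∀ i < j, L (orthoPoly L j * orthoPoly L i) = 0 := by
  induction j using Nat.strong_induction_on with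
  | _ j ih =>
    match j, ih, h with
    | 0, _, _ => intro i hi; omega
    | 1, _, h =>
      intro i hi
      obtain rfl : i = 0 := by omega
      have h0 := h 0 (by omega)
      have e : orthoPoly L 1 * orthoPoly L 0
          = X * orthoPoly L 0 * orthoPoly L 0
            - C (jacobiDiag L 0) * (orthoPoly L 0 * orthoPoly L 0) := by
        rw [mul_assoc X, orthoPoly_zero, mul_one, mul_one, mul_one]
        have := orthoPoly_succ_zero (L := L); rw [orthoPoly_zero, mul_one] at this
        rw [this]; ring
      rw [e, map_sub, map_C_mul, jacobiDiag]
      change _ - _ * orthoNormSq L 0 = 0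
      field_simp; ring
    | j + 2, ih, h =>
      intro i hi
      have o1 := ih (j + 1) (by omega) (fun i hi => h i (by omega))
      have o0 := ih j (by omega) (fun i hi => h i (by omega))
      have e : orthoPoly L (j + 2) * orthoPoly L i = orthoPoly L (j + 1) * (X * orthoPoly L i)
          - C (jacobiDiag L (j + 1)) * (orthoPoly L (j + 1) * orthoPoly L i)
          - C (jacobiOffSq L j) * (orthoPoly L j * orthoPoly L i) := by
        have := orthoPoly_succ_succ (L := L) j
        linear_combination (-orthoPoly L i) * this
      rw [e, map_sub, map_sub, map_C_mul, map_C_mul]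
      have hj1 := h (j + 1) (by omega)
      have hj0 := h j (by omega)
      rcases Nat.lt_trichotomy i j with hij | hij | hij
      · obtain ⟨R, hR, hX⟩ := exists_X_mul_orthoPoly (L := L) i
        have hRz : L (orthoPoly L (j + 1) * R) = 0 := by
          rcases hR with ⟨-, rfl⟩ | ⟨l, rfl, rfl⟩
          · simp
          · rw [mul_left_comm, map_C_mul, o1 l (by omega), mul_zero]
        rw [hX, mul_add, mul_add, map_add, map_add, hRz, mul_left_comm, map_C_mul,
          o1 (i + 1) (by omega), o1 i (by omega), o0 i (by omega)]
        ring
      · subst hij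
        obtain ⟨R, hR, hX⟩ := exists_X_mul_orthoPoly (L := L) i
        have hRz : L (orthoPoly L (i + 1) * R) = 0 := by
          rcases hR with ⟨-, rfl⟩ | ⟨l, rfl, rfl⟩
          · simp
          · rw [mul_left_comm, map_C_mul, o1 l (by omega), mul_zero]
        rw [hX, mul_add, mul_add, map_add, map_add, hRz, mul_left_comm, map_C_mul,
          o1 i (by omega)]
        change orthoNormSq L (i + 1) + _ + _ - _ - _ * orthoNormSq L i = 0
        rw [jacobiOffSq]; field_simp; ring
      · obtain rfl : i = j + 1 := by omega
        have o1' : L (orthoPoly L j * orthoPoly L (j + 1)) = 0 := by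
          rw [mul_comm]; exact o1 j (by omega)
        have e2 : orthoPoly L (j + 1) * (X * orthoPoly L (j + 1))
          = X * orthoPoly L (j + 1) * orthoPoly L (j + 1) := by ring
        rw [o1', e2, jacobiDiag]
        change _ - _ * orthoNormSq L (j + 1) - _ = 0
        field_simp; ring

lemma map_orthoPoly_mul_X_pow (j : ℕ) (h : ∀ i < j, orthoNormSq L i ≠ 0) (m i : ℕ)
    (hmi : m + i < j) : L (orthoPoly L j * (X ^ m * orthoPoly L i)) = 0 := by
  induction m generalizing i with
  | zero => simpa using map_orthoPoly_mul_orthoPoly j h i (by omega)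
  | succ m ih =>
    obtain ⟨R, hR, hX⟩ := exists_X_mul_orthoPoly (L := L) i
    have hRz : L (orthoPoly L j * (X ^ m * R)) = 0 := by
      rcases hR with ⟨-, rfl⟩ | ⟨l, rfl, rfl⟩
      · simp
      · rw [mul_left_comm (X ^ m), mul_left_comm, map_C_mul, ih l (by omega), mul_zero]
    rw [pow_succ, mul_assoc (X ^ m), hX, mul_add, mul_add, mul_add, mul_add, map_add, map_add,
      hRz, ih (i + 1) (by omega), mul_left_comm (X ^ m), mul_left_comm, map_C_mul,
      ih i (by omega)]
    ring

lemma map_orthoPoly_mul_of_degree_lt (j : ℕ) (h : ∀ i < j, orthoNormSq L i ≠ 0) (q : ℝ[X])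
    (hq : q.degree < j) : L (orthoPoly L j * q) = 0 := by
  rw [q.as_sum_support_C_mul_X_pow, Finset.mul_sum, map_sum]
  refine Finset.sum_eq_zero fun m hm => ?_
  have : m < j := by
    have := le_degree_of_mem_supp m hm
    exact_mod_cast this.trans_lt hq
  have := map_orthoPoly_mul_X_pow j h m 0 (by omega)
  rw [orthoPoly_zero, mul_one] at this
  rw [mul_left_comm, map_C_mul, this, mul_zero]

/-- The minimality of the monic orthogonal polynomial, in the form of Pythagoras' theorem. -/
lemma map_sq_eq_orthoNormSq_add (j : ℕ) (h : ∀ i < j, orthoNormSq L i ≠ 0) (p : ℝ[X])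
    (hp : p.Monic) (hd : p.natDegree = j) :
    L (p * p) = orthoNormSq L j + L ((orthoPoly L j - p) * (orthoPoly L j - p)) := by
  obtain ⟨h1, h2⟩ := monic_natDegree_orthoPoly (L := L) j
  have hdeg : (orthoPoly L j - p).degree < j := by
    refine (degree_sub_lt_left ?_ h1.ne_zero ?_).trans_eq ?_
    · rw [degree_eq_natDegree h1.ne_zero, degree_eq_natDegree hp.ne_zero, h2, hd]
    · rw [h1.leadingCoeff, hp.leadingCoeff]
    · rw [degree_eq_natDegree h1.ne_zero, h2]
  have ho := map_orthoPoly_mul_of_degree_lt j h _ hdeg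
  have e : p * p = orthoPoly L j * orthoPoly L j
      + (orthoPoly L j - p) * (orthoPoly L j - p)
      - (2 : ℝ) • (orthoPoly L j * (orthoPoly L j - p)) := by
    rw [smul_eq_C_mul]; simp only [map_ofNat]; ring
  rw [e, map_sub, map_add, map_smul, ho, orthoNormSq]; simp

/-- The Cauchy–Schwarz inequality for a positive functional. -/
lemma IsBddPos.cauchySchwarz (hL : IsBddPos L M) (p q : ℝ[X]) :
    L (p * q) ^ 2 ≤ L (p * p) * L (q * q) := by
  have h : ∀ t : ℝ, 0 ≤ L (q * q) * (t * t) + (2 * L (p * q)) * t + L (p * p) := by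
    intro t
    have := hL.nonneg (p + C t * q)
    have e : (p + C t * q) * (p + C t * q) = p * p + C (2 * t) * (p * q) + C (t * t) * (q * q) := by
      simp only [C_mul, map_ofNat]; ring
    rw [e, map_add, map_add, map_C_mul, map_C_mul] at this
    linarith
  have := discrim_le_zero h
  rw [discrim] at this
  nlinarith

lemma IsBddPos.map_X_mul_sq_le (hL : IsBddPos L M) (p q : ℝ[X]) :
    L (X * p * q) ^ 2 ≤ M ^ 2 * L (p * p) * L (q * q) :=
  (hL.cauchySchwarz _ _).trans (mul_le_mul_of_nonneg_right (hL.bdd p) (hL.nonneg q))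

lemma IsBddPos.abs_jacobiDiag_le (hL : IsBddPos L M) (hM : 0 ≤ M) (j : ℕ) :
    |jacobiDiag L j| ≤ M := by
  have h := hL.map_X_mul_sq_le (orthoPoly L j) (orthoPoly L j)
  have h0 := hL.nonneg (orthoPoly L j)
  rw [jacobiDiag, abs_div, orthoNormSq, abs_of_nonneg h0]
  refine div_le_of_le_mul₀ h0 hM ?_
  refine abs_le_of_sq_le_sq ?_ (by positivity)
  linarith [h]

lemma IsBddPos.orthoNormSq_nonneg (hL : IsBddPos L M) (j : ℕ) : 0 ≤ orthoNormSq L j :=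
  hL.nonneg _

lemma IsBddPos.orthoNormSq_zero (hL : IsBddPos L M) : orthoNormSq L 0 = 1 := by
  simp [orthoNormSq, orthoPoly_zero, hL.map_one]

lemma IsBddPos.orthoNormSq_le_of_monic (hL : IsBddPos L M) (j : ℕ)
    (h : ∀ i < j, orthoNormSq L i ≠ 0) (p : ℝ[X]) (hp : p.Monic) (hd : p.natDegree = j) :
    orthoNormSq L j ≤ L (p * p) := by
  rw [map_sq_eq_orthoNormSq_add j h p hp hd]
  exact le_add_of_nonneg_right (hL.nonneg _)

lemma IsBddPos.orthoNormSq_succ_le (hL : IsBddPos L M) (j : ℕ)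
    (h : ∀ i < j + 1, orthoNormSq L i ≠ 0) : orthoNormSq L (j + 1) ≤ M ^ 2 * orthoNormSq L j := by
  obtain ⟨h1, h2⟩ := monic_natDegree_orthoPoly (L := L) j
  refine (hL.orthoNormSq_le_of_monic (j + 1) h (X * orthoPoly L j) (monic_X.mul h1) ?_).trans
    (hL.bdd _)
  rw [natDegree_X_mul h1.ne_zero, h2]

lemma IsBddPos.jacobiOffSq_nonneg (hL : IsBddPos L M) (j : ℕ) : 0 ≤ jacobiOffSq L j :=
  div_nonneg (hL.orthoNormSq_nonneg _) (hL.orthoNormSq_nonneg _)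

lemma IsBddPos.jacobiOffSq_le (hL : IsBddPos L M) (j : ℕ)
    (h : ∀ i < j + 1, orthoNormSq L i ≠ 0) : jacobiOffSq L j ≤ M ^ 2 :=
  div_le_of_le_mul₀ (hL.orthoNormSq_nonneg _) (by positivity) (hL.orthoNormSq_succ_le j h)

lemma IsBddPos.orthoNormSq_le_pow (hL : IsBddPos L M) (hM : 1 ≤ M) {k : ℕ} (j : ℕ) (hjk : j ≤ k)
    (h : ∀ i < j, orthoNormSq L i ≠ 0) : orthoNormSq L j ≤ (M ^ k) ^ 2 := by
  have : orthoNormSq L j ≤ (M ^ 2) ^ j := by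
    clear hjk
    induction j with
    | zero => simp [hL.orthoNormSq_zero]
    | succ j ih =>
      refine (hL.orthoNormSq_succ_le j h).trans ?_
      rw [pow_succ' (M ^ 2)]
      exact mul_le_mul_of_nonneg_left (ih fun i hi => h i (by omega)) (by positivity)
  refine this.trans ?_
  rw [← pow_mul, ← pow_mul, mul_comm k]
  exact pow_le_pow_right₀ hM (by omega)

/-- The orthogonal polynomials have exponentially bounded coefficients: a functional `Δ` that is
bounded by `B` on the multiples `X ^ m * q` is bounded by `B (1 + 2 M) ^ i` on the multiples
`X ^ m * P_i * q`. -/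
lemma IsBddPos.abs_map_orthoPoly_le (hL : IsBddPos L M) (hM : 0 ≤ M) (Δ : ℝ[X] →ₗ[ℝ] ℝ)
    (q : ℝ[X]) (B : ℝ) (N : ℕ) (hB : ∀ m ≤ N, |Δ (X ^ m * q)| ≤ B) (i : ℕ)
    (h : ∀ l < i, orthoNormSq L l ≠ 0) (m : ℕ) (hm : m + i ≤ N) :
    |Δ (X ^ m * (orthoPoly L i * q))| ≤ B * (1 + 2 * M) ^ i := by
  have hB0 : 0 ≤ B := (abs_nonneg _).trans (hB 0 (by omega))
  induction i using Nat.strong_induction_on generalizing m with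
  | _ i ih =>
    match i, ih, h, hm with
    | 0, _, _, hm => simpa [orthoPoly_zero] using hB m (by omega)
    | 1, _, _, hm =>
      have e : X ^ m * (orthoPoly L 1 * q)
          = X ^ (m + 1) * q - C (jacobiDiag L 0) * (X ^ m * q) := by
        have := orthoPoly_succ_zero (L := L); rw [orthoPoly_zero, mul_one] at this
        linear_combination (-(X ^ m * q)) * this
      rw [e, map_sub, map_C_mul]
      refine (abs_sub _ _).trans ?_
      rw [abs_mul]
      have h1 := hB (m + 1) (by omega)
      have h2 := hB m (by omega)
      have h3 := mul_le_mul (hL.abs_jacobiDiag_le hM 0) h2 (abs_nonneg _) hM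
      nlinarith
    | i + 2, ih, h, hm =>
      have e : X ^ m * (orthoPoly L (i + 2) * q)
          = X ^ (m + 1) * (orthoPoly L (i + 1) * q)
            - C (jacobiDiag L (i + 1)) * (X ^ m * (orthoPoly L (i + 1) * q))
            - C (jacobiOffSq L i) * (X ^ m * (orthoPoly L i * q)) := by
        have := orthoPoly_succ_succ (L := L) i
        linear_combination (-(X ^ m * q)) * this
      rw [e, map_sub, map_sub, map_C_mul, map_C_mul]
      refine (abs_sub _ _).trans ((add_le_add (abs_sub _ _) le_rfl).trans ?_)
      rw [abs_mul, abs_mul, abs_of_nonneg (hL.jacobiOffSq_nonneg i)]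
      have h1 := ih (i + 1) (by omega) (fun l hl => h l (by omega)) (m + 1) (by omega)
      have h2 := ih (i + 1) (by omega) (fun l hl => h l (by omega)) m (by omega)
      have h3 := ih i (by omega) (fun l hl => h l (by omega)) m (by omega)
      have h4 := mul_le_mul (hL.abs_jacobiDiag_le hM (i + 1)) h2 (abs_nonneg _) hM
      have h5 := mul_le_mul (hL.jacobiOffSq_le i fun l hl => h l (by omega)) h3 (abs_nonneg _)
        (by positivity)
      have hP : 0 ≤ B * (1 + 2 * M) ^ i := by positivity
      calc _ ≤ _ := add_le_add (add_le_add h1 h4) h5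
        _ = (B * (1 + 2 * M) ^ i) * ((1 + M) * (1 + 2 * M) + M ^ 2) := by ring
        _ ≤ (B * (1 + 2 * M) ^ i) * (1 + 2 * M) ^ 2 :=
            mul_le_mul_of_nonneg_left (by nlinarith) hP
        _ = _ := by ring

/-- Two functionals whose first moments are close are close on `X ^ m * P_j ^ 2`. -/
lemma IsBddPos.abs_map_sub_map_orthoPoly_sq_le (hL : IsBddPos L M) (hM : 1 ≤ M)
    {L₁ L₂ : ℝ[X] →ₗ[ℝ] ℝ} {δ : ℝ} {k : ℕ}
    (hδ : ∀ m ≤ 2 * k + 1, |L₁ (X ^ m) - L₂ (X ^ m)| ≤ δ) (j : ℕ) (hj : j ≤ k)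
    (h : ∀ l < j, orthoNormSq L l ≠ 0) (m : ℕ) (hm : m ≤ 1) :
    |L₁ (X ^ m * (orthoPoly L j * orthoPoly L j)) - L₂ (X ^ m * (orthoPoly L j * orthoPoly L j))|
      ≤ δ * (1 + 2 * M) ^ (2 * k + 1) := by
  have hM0 : 0 ≤ M := by linarith
  have h1 := hL.abs_map_orthoPoly_le hM0 (L₁ - L₂) 1 δ (2 * k + 1)
    (fun m hm => by simpa using hδ m hm) j h
  have h2 := hL.abs_map_orthoPoly_le hM0 (L₁ - L₂) (orthoPoly L j) (δ * (1 + 2 * M) ^ j)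
    (2 * k + 1 - j) (fun m hm => by simpa using h1 m (by omega)) j h m (by omega)
  rw [LinearMap.sub_apply, mul_assoc δ, ← pow_add] at h2
  have hδ0 : 0 ≤ δ := (abs_nonneg _).trans (hδ 0 (by omega))
  exact h2.trans (mul_le_mul_of_nonneg_left
    (pow_le_pow_right₀ (by linarith) (by omega)) hδ0)

end Algebra

/-! ### Stability of the Jacobi coefficients -/

section Stability

/-- Stability of quotients `a = x / y` and `a' = x' / y'`. -/
lemma abs_sub_mul_le {a a' x x' y y' b r t : ℝ} (hy' : 0 < y') (h : a * y = x) (h' : a' * y' = x')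
    (ha : |a| ≤ b) (hx : |x - x'| ≤ r) (hy : |y - y'| ≤ t) : |a - a'| * y' ≤ r + b * t := by
  have e : (a - a') * y' = (x - x') - a * (y - y') := by rw [← h, ← h']; ring
  have e2 : |a - a'| * y' = |(a - a') * y'| := by rw [abs_mul, abs_of_pos hy']
  rw [e2, e]
  refine (abs_sub _ _).trans (add_le_add hx ?_)
  rw [abs_mul]
  exact mul_le_mul ha hy (abs_nonneg _) ((abs_nonneg _).trans ha)

variable {L L' : ℝ[X] →ₗ[ℝ] ℝ} {M : ℝ}

/-- The norms of the orthogonal polynomials are stable: both functionals nearly attain the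
minimum of the other one. -/
lemma IsBddPos.orthoNormSq_stable (hL : IsBddPos L M) (hL' : IsBddPos L' M) (hM : 1 ≤ M) {k : ℕ}
    {δ κ : ℝ} (hκ : ∀ p : ℝ[X], p.Monic → p.natDegree ≤ k → κ ≤ L' (p * p)) (hκ0 : 0 < κ)
    (hδ : ∀ m ≤ 2 * k + 1, |L (X ^ m) - L' (X ^ m)| ≤ δ)
    (hs : δ * (1 + 2 * M) ^ (2 * k + 1) ≤ κ / 2) (j : ℕ) (hj : j ≤ k) :
    κ ≤ orthoNormSq L' j ∧ 0 < orthoNormSq L j ∧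
      |orthoNormSq L j - orthoNormSq L' j| ≤ δ * (1 + 2 * M) ^ (2 * k + 1) := by
  have hpos' : ∀ i ≤ k, κ ≤ orthoNormSq L' i := fun i hi =>
    hκ _ (monic_natDegree_orthoPoly i).1 ((monic_natDegree_orthoPoly i).2.le.trans hi)
  have hne' : ∀ i ≤ k, orthoNormSq L' i ≠ 0 := fun i hi => (hκ0.trans_le (hpos' i hi)).ne'
  induction j using Nat.strong_induction_on with
  | _ j ih =>
    have hne : ∀ l < j, orthoNormSq L l ≠ 0 := fun l hl => (ih l hl (by omega)).2.1.ne'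
    have h1 := hL.abs_map_sub_map_orthoPoly_sq_le hM hδ j hj hne 0 (by omega)
    have h2 := hL'.abs_map_sub_map_orthoPoly_sq_le hM hδ j hj
      (fun l hl => hne' l (by omega)) 0 (by omega)
    rw [pow_zero, one_mul] at h1 h2
    have h3 := hL'.orthoNormSq_le_of_monic j (fun l hl => hne' l (by omega)) (orthoPoly L j)
      (monic_natDegree_orthoPoly j).1 (monic_natDegree_orthoPoly j).2
    have h4 := hL.orthoNormSq_le_of_monic j hne (orthoPoly L' j)
      (monic_natDegree_orthoPoly j).1 (monic_natDegree_orthoPoly j).2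
    change |orthoNormSq L j - _| ≤ _ at h1
    change |_ - orthoNormSq L' j| ≤ _ at h2
    have h5 := hpos' j hj
    rw [abs_le] at h1 h2
    refine ⟨h5, by linarith [h1.1], ?_⟩
    rw [abs_le]
    constructor <;> linarith [h1.1, h2.2]

/-- Stability of the Jacobi coefficients. If the squared `L'`-norms of monic polynomials of degree
at most `k` are at least `κ`, a perturbation `δ` of the moments that is small compared with `κ` and
with an exponential in `k` changes the first Jacobi coefficients only little. In contrast to
estimates by way of the recurrence, whose errors multiply in each step, the loss is only
exponential in `k`, because each orthogonal polynomial is compared with its counterpart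
through minimality. -/
theorem IsBddPos.jacobi_stable (hL : IsBddPos L M) (hL' : IsBddPos L' M) (hM : 1 ≤ M) {k : ℕ}
    {δ κ ε : ℝ} (hκ : ∀ p : ℝ[X], p.Monic → p.natDegree ≤ k → κ ≤ L' (p * p)) (hκ0 : 0 < κ)
    (hδ : ∀ m ≤ 2 * k + 1, |L (X ^ m) - L' (X ^ m)| ≤ δ) (hε : ε ≤ 1)
    (hs : 6 * M ^ (k + 1) * √(δ * (1 + 2 * M) ^ (2 * k + 1)) ≤ ε * κ) :
    (∀ j ≤ k, 0 < orthoNormSq L j) ∧ (∀ j ≤ k, |jacobiDiag L j - jacobiDiag L' j| ≤ ε) ∧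
      ∀ j < k, |√(jacobiOffSq L j) - √(jacobiOffSq L' j)| ≤ ε := by
  set ζ := δ * (1 + 2 * M) ^ (2 * k + 1) with hζ
  have hδ0 : 0 ≤ δ := (abs_nonneg _).trans (hδ 0 (by omega))
  have hM0 : 0 < M := by linarith
  have hζ0 : 0 ≤ ζ := by positivity
  set s := √ζ with hs_def
  have hs0 : 0 ≤ s := Real.sqrt_nonneg _
  have hss : s * s = ζ := Real.mul_self_sqrt hζ0
  have hκ1 : κ ≤ 1 := by
    have := hκ 1 monic_one (by simp)
    rwa [one_mul, hL'.map_one] at this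
  have hMk : 1 ≤ M ^ k := one_le_pow₀ hM
  have hMk1 : M ^ (k + 1) = M ^ k * M := pow_succ _ _
  have hMk2 : 1 ≤ M ^ k * M := by nlinarith
  rw [hMk1] at hs
  have hε0 : 0 ≤ ε := by
    by_contra! hneg
    have : ε * κ < 0 := mul_neg_of_neg_of_pos hneg hκ0
    have : 0 ≤ 6 * (M ^ k * M) * s := by positivity
    linarith
  have hsκ : 6 * s ≤ ε * κ := by nlinarith
  have hsκ' : 6 * s ≤ κ := by nlinarith
  have hs1 : s ≤ 1 := by linarith
  have hζκ : ζ ≤ κ / 2 := by nlinarith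
  have key := hL.orthoNormSq_stable hL' hM hκ hκ0 hδ hζκ
  have hpos : ∀ j ≤ k, 0 < orthoNormSq L j := fun j hj => (key j hj).2.1
  have hκ' : ∀ j ≤ k, κ ≤ orthoNormSq L' j := fun j hj => (key j hj).1
  have hpos' : ∀ j ≤ k, 0 < orthoNormSq L' j := fun j hj => hκ0.trans_le (hκ' j hj)
  refine ⟨hpos, fun j hj => ?_, fun j hj => ?_⟩
  · have hne : ∀ i < j, orthoNormSq L i ≠ 0 := fun i hi => (hpos i (by omega)).ne'
    have hne' : ∀ i < j, orthoNormSq L' i ≠ 0 := fun i hi => (hpos' i (by omega)).ne'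
    set P := orthoPoly L j with hP
    set P' := orthoPoly L' j with hP'
    have hd := abs_le.1 (key j hj).2.2
    have hup := hL.orthoNormSq_le_pow hM j hj hne
    have hsq := hL'.abs_map_sub_map_orthoPoly_sq_le hM hδ j hj hne' 0 (by omega)
    rw [pow_zero, one_mul, ← hP'] at hsq
    change |L (P' * P') - orthoNormSq L' j| ≤ ζ at hsq
    have hX := hL'.abs_map_sub_map_orthoPoly_sq_le hM hδ j hj hne' 1 (by omega)
    rw [pow_one, ← hP', ← mul_assoc] at hX
    have hpyth := map_sq_eq_orthoNormSq_add j hne P' (monic_natDegree_orthoPoly j).1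
      (monic_natDegree_orthoPoly j).2
    rw [← hP] at hpyth
    have hQ : L ((P - P') * (P - P')) ≤ 2 * ζ := by linarith [(abs_le.1 hsq).2]
    have hS : L ((P + P') * (P + P')) ≤ 8 * (M ^ k) ^ 2 := by
      have e : (P + P') * (P + P') = (2 : ℝ) • (P * P) + (2 : ℝ) • (P' * P')
          - (P - P') * (P - P') := by
        simp only [smul_eq_C_mul, map_ofNat]; ring
      have h0 := hL.nonneg (P - P')
      have h1 : L (P * P) = orthoNormSq L j := rfl
      rw [e, map_sub, map_add, map_smul, map_smul, smul_eq_mul, smul_eq_mul, h1]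
      nlinarith [(abs_le.1 hsq).2]
    have hCS := hL.map_X_mul_sq_le (P - P') (P + P')
    have hdiff : |L (X * P * P) - L (X * P' * P')| ≤ 4 * (M ^ k * M) * s := by
      have e : X * P * P - X * P' * P' = X * (P - P') * (P + P') := by ring
      rw [← map_sub, e]
      refine abs_le_of_sq_le_sq ?_ (by positivity)
      calc _ ≤ _ := hCS
        _ ≤ M ^ 2 * (2 * ζ) * (8 * (M ^ k) ^ 2) := by
          gcongr
          exact hL.nonneg _
        _ = _ := by rw [← hss]; ring
    have ha : |jacobiDiag L j| ≤ M := hL.abs_jacobiDiag_le hM0.le j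
    have hLj := hpos j hj
    have hLj' := hpos' j hj
    have e1 : jacobiDiag L j * orthoNormSq L j = L (X * P * P) := div_mul_cancel₀ _ hLj.ne'
    have e2 : jacobiDiag L' j * orthoNormSq L' j = L' (X * P' * P') := div_mul_cancel₀ _ hLj'.ne'
    have hdiff' : |L (X * P * P) - L' (X * P' * P')| ≤ 4 * (M ^ k * M) * s + ζ :=
      (abs_sub_le _ _ _).trans (add_le_add hdiff hX)
    have h6 : |jacobiDiag L j - jacobiDiag L' j| * orthoNormSq L' j ≤ 6 * (M ^ k * M) * s := by
      refine (abs_sub_mul_le hLj' e1 e2 ha hdiff' (key j hj).2.2).trans ?_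
      have h1 : ζ ≤ s := by rw [← hss]; exact mul_le_of_le_one_left hs0 hs1
      have h2 : ζ ≤ M ^ k * M * s := h1.trans (le_mul_of_one_le_left hs0 hMk2)
      have h3 : M * ζ ≤ M ^ k * M * s :=
        mul_le_mul (le_mul_of_one_le_left hM0.le hMk) h1 hζ0 (by positivity)
      linarith
    have h7 := (h6.trans hs)
    have h8 : |jacobiDiag L j - jacobiDiag L' j| * orthoNormSq L' j ≤ ε * orthoNormSq L' j :=
      h7.trans (mul_le_mul_of_nonneg_left (hκ' j hj) hε0)
    exact le_of_mul_le_mul_right h8 hLj'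
  · have hne : ∀ i < j + 1, orthoNormSq L i ≠ 0 := fun i hi => (hpos i (by omega)).ne'
    have hLj := hpos j hj.le
    have hLj' := hpos' j hj.le
    have hb := hL.jacobiOffSq_le j hne
    have hb0 := hL.jacobiOffSq_nonneg j
    have hb0' := hL'.jacobiOffSq_nonneg j
    have e1 : jacobiOffSq L j * orthoNormSq L j = orthoNormSq L (j + 1) :=
      div_mul_cancel₀ _ hLj.ne'
    have e2 : jacobiOffSq L' j * orthoNormSq L' j = orthoNormSq L' (j + 1) :=
      div_mul_cancel₀ _ hLj'.ne'
    have h6 : |jacobiOffSq L j - jacobiOffSq L' j| * orthoNormSq L' j ≤ 2 * M ^ 2 * ζ := by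
      refine (abs_sub_mul_le (b := M ^ 2) hLj' e1 e2 (by rwa [abs_of_nonneg hb0])
        (key (j + 1) hj).2.2 (key j hj.le).2.2).trans ?_
      rw [← hζ]
      linarith [mul_le_mul_of_nonneg_right (one_le_pow₀ hM : 1 ≤ M ^ 2) hζ0]
    have h7 : 2 * M ^ 2 * ζ ≤ ε ^ 2 * κ := by
      have h8 : 6 * M * s ≤ ε * κ := by
        refine le_trans ?_ hs
        nlinarith [mul_nonneg hM0.le hs0]
      have h9 : (6 * M * s) ^ 2 ≤ (ε * κ) ^ 2 := pow_le_pow_left₀ (by positivity) h8 2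
      have h10 : (ε * κ) ^ 2 ≤ ε ^ 2 * κ := by
        rw [mul_pow]
        exact mul_le_mul_of_nonneg_left (by nlinarith) (by positivity)
      have h11 : 2 * M ^ 2 * ζ ≤ (6 * M * s) ^ 2 := by
        rw [← hss]; nlinarith [sq_nonneg (M * s)]
      linarith
    have h8 : |jacobiOffSq L j - jacobiOffSq L' j| ≤ ε ^ 2 := by
      refine le_of_mul_le_mul_right (h6.trans (h7.trans ?_)) hLj'
      exact mul_le_mul_of_nonneg_left (hκ' j hj.le) (by positivity)
    -- `|√x - √y| ^ 2 ≤ |√x - √y| (√x + √y) = |x - y|`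
    refine abs_le_of_sq_le_sq (le_trans ?_ h8) hε0
    have hx := Real.sqrt_nonneg (jacobiOffSq L j)
    have hy := Real.sqrt_nonneg (jacobiOffSq L' j)
    have e4 : jacobiOffSq L j - jacobiOffSq L' j = (√(jacobiOffSq L j) - √(jacobiOffSq L' j)) *
        (√(jacobiOffSq L j) + √(jacobiOffSq L' j)) := by
      have h1 := Real.mul_self_sqrt hb0
      have h2 := Real.mul_self_sqrt hb0'
      linear_combination h2 - h1
    rw [e4, abs_mul, ← sq_abs, sq, abs_of_nonneg (add_nonneg hx hy)]
    refine mul_le_mul_of_nonneg_left ?_ (abs_nonneg _)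
    exact (abs_sub _ _).trans (by rw [abs_of_nonneg hx, abs_of_nonneg hy])

end Stability

/-! ### Lanczos vectors as orthogonal polynomials -/

section LanczosOrtho

variable {n : ℕ} (A : Matrix (Fin n) (Fin n) ℂ) (u : EuclideanSpace ℂ (Fin n))

lemma toEuclideanCLM_real_smul (r : ℝ) (B : Matrix (Fin n) (Fin n) ℂ) :
    Matrix.toEuclideanCLM (𝕜 := ℂ) (r • B) u = r • Matrix.toEuclideanCLM (𝕜 := ℂ) B u := by
  rw [show r • B = (r : ℂ) • B from (Complex.coe_smul r B).symm, map_smul,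
    smul_apply, Complex.coe_smul]

/-- The vector `p(A) u`, as a function of the real polynomial `p`. -/
noncomputable def polyVec : ℝ[X] →ₗ[ℝ] EuclideanSpace ℂ (Fin n) where
  toFun p := Matrix.toEuclideanCLM (𝕜 := ℂ) (aeval A p) u
  map_add' p q := by rw [map_add, map_add, add_apply]
  map_smul' r p := by rw [map_smul, toEuclideanCLM_real_smul]; rfl

/-- The functional `p ↦ ⟨u, p(A) u⟩`, integration against the spectral measure of `A` at `u`. -/
noncomputable def vecFunctional : ℝ[X] →ₗ[ℝ] ℝ :=
  (Complex.reLm ∘ₗ ((innerₛₗ ℂ u).restrictScalars ℝ)) ∘ₗ polyVec A u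

variable {A u}

lemma vecFunctional_apply (p : ℝ[X]) :
    vecFunctional A u p = (inner ℂ u (Matrix.toEuclideanCLM (𝕜 := ℂ) (aeval A p) u)).re := rfl

lemma toEuclideanCLM_polyVec (p : ℝ[X]) :
    Matrix.toEuclideanCLM (𝕜 := ℂ) A (polyVec A u p) = polyVec A u (X * p) := by
  change _ = Matrix.toEuclideanCLM (𝕜 := ℂ) (aeval A (X * p)) u
  rw [map_mul, aeval_X, map_mul]; rfl

lemma polyVec_one : polyVec A u 1 = u := by
  change Matrix.toEuclideanCLM (𝕜 := ℂ) (aeval A (1 : ℝ[X])) u = u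
  simp

lemma polyVec_C_mul (r : ℝ) (p : ℝ[X]) : polyVec A u (C r * p) = (r : ℂ) • polyVec A u p := by
  rw [← smul_eq_C_mul, map_smul, Complex.coe_smul]

lemma isHermitian_aeval (hA : A.IsHermitian) (p : ℝ[X]) : (aeval A p).IsHermitian := by
  induction p using Polynomial.induction_on' with
  | add p q hp hq => rw [map_add]; exact hp.add hq
  | monomial m r =>
    rw [aeval_monomial, Algebra.algebraMap_eq_smul_one, smul_one_mul]
    rw [Matrix.IsHermitian, Matrix.conjTranspose_smul, (hA.pow m).eq, star_trivial]

lemma inner_toEuclideanCLM_left {B : Matrix (Fin n) (Fin n) ℂ} (hB : B.IsHermitian)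
    (x y : EuclideanSpace ℂ (Fin n)) :
    inner ℂ (Matrix.toEuclideanCLM (𝕜 := ℂ) B x) y
      = inner ℂ x (Matrix.toEuclideanCLM (𝕜 := ℂ) B y) := by
  have h : star (Matrix.toEuclideanCLM (𝕜 := ℂ) B) = Matrix.toEuclideanCLM (𝕜 := ℂ) B := by
    rw [← map_star, Matrix.star_eq_conjTranspose, hB.eq]
  rw [ContinuousLinearMap.star_eq_adjoint] at h
  conv_lhs => rw [← h]
  exact ContinuousLinearMap.adjoint_inner_left _ _ _

lemma inner_polyVec (hA : A.IsHermitian) (p q : ℝ[X]) :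
    inner ℂ (polyVec A u p) (polyVec A u q) = (vecFunctional A u (p * q) : ℂ) := by
  have h : inner ℂ (polyVec A u p) (polyVec A u q)
      = inner ℂ u (Matrix.toEuclideanCLM (𝕜 := ℂ) (aeval A (p * q)) u) := by
    change inner ℂ (Matrix.toEuclideanCLM (𝕜 := ℂ) (aeval A p) u)
      (Matrix.toEuclideanCLM (𝕜 := ℂ) (aeval A q) u) = _
    rw [inner_toEuclideanCLM_left (isHermitian_aeval hA p), map_mul, map_mul]; rfl
  rw [h, vecFunctional_apply, eq_comm]
  refine Complex.conj_eq_iff_re.1 ?_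
  rw [inner_conj_symm, inner_toEuclideanCLM_left (isHermitian_aeval hA _)]

lemma norm_polyVec_sq (hA : A.IsHermitian) (p : ℝ[X]) :
    ‖polyVec A u p‖ ^ 2 = vecFunctional A u (p * p) := by
  have := inner_self_eq_norm_sq_to_K (𝕜 := ℂ) (polyVec A u p)
  rw [inner_polyVec hA] at this
  refine Complex.ofReal_injective ?_
  rw [this, Complex.ofReal_pow]; rfl

lemma isBddPos_vecFunctional (hA : A.IsHermitian) {M : ℝ}
    (hM : ‖Matrix.toEuclideanCLM (𝕜 := ℂ) A‖ ≤ M) (hu : ‖u‖ = 1) :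
    IsBddPos (vecFunctional A u) M where
  map_one := by
    have := norm_polyVec_sq (u := u) hA 1
    rw [polyVec_one, hu, mul_one] at this
    rw [← this]; norm_num
  nonneg p := by rw [← norm_polyVec_sq hA]; positivity
  bdd p := by
    rw [← norm_polyVec_sq hA, ← norm_polyVec_sq hA, ← toEuclideanCLM_polyVec, ← mul_pow]
    exact pow_le_pow_left₀ (norm_nonneg _) ((ContinuousLinearMap.le_opNorm _ _).trans
      (mul_le_mul_of_nonneg_right hM (norm_nonneg _))) 2

lemma norm_polyVec_orthoPoly (hA : A.IsHermitian) (j : ℕ) :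
    ‖polyVec A u (orthoPoly (vecFunctional A u) j)‖
      = √(orthoNormSq (vecFunctional A u) j) := by
  rw [orthoNormSq, ← norm_polyVec_sq hA, Real.sqrt_sq (norm_nonneg _)]

/-- If `v_0, …, v_j` are the normalized vectors `P_i(A) u`, the projection of `A v_j` in the
Lanczos step is `P_{j+1}(A) u / ‖P_j(A) u‖`. -/
lemma starProjection_lanczosSpace (hA : A.IsHermitian) (j : ℕ)
    (h : ∀ i ≤ j, 0 < orthoNormSq (vecFunctional A u) i)
    (hv : ∀ i ≤ j, lanczosVec A u i = (((√(orthoNormSq (vecFunctional A u) i))⁻¹ : ℝ) : ℂ) •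
      polyVec A u (orthoPoly (vecFunctional A u) i)) :
    (lanczosSpace A u j)ᗮ.starProjection (Matrix.toEuclideanCLM (𝕜 := ℂ) A (lanczosVec A u j))
      = (((√(orthoNormSq (vecFunctional A u) j))⁻¹ : ℝ) : ℂ) •
        polyVec A u (orthoPoly (vecFunctional A u) (j + 1)) := by
  set L := vecFunctional A u with hL
  have hmem : ∀ i ≤ j, polyVec A u (orthoPoly L i) ∈ lanczosSpace A u j := by
    intro i hi
    have h1 : lanczosVec A u i ∈ lanczosSpace A u j :=
      Submodule.subset_span ⟨⟨i, by omega⟩, rfl⟩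
    have h2 : polyVec A u (orthoPoly L i) = ((√(orthoNormSq L i) : ℝ) : ℂ) • lanczosVec A u i := by
      rw [hv i hi, smul_smul, ← Complex.ofReal_mul,
        mul_inv_cancel₀ (Real.sqrt_pos.2 (h i hi)).ne', Complex.ofReal_one, one_smul]
    rw [h2]
    exact Submodule.smul_mem _ _ h1
  have horth : polyVec A u (orthoPoly L (j + 1)) ∈ (lanczosSpace A u j)ᗮ := by
    rw [lanczosSpace, Submodule.mem_orthogonal]
    intro w hw
    induction hw using Submodule.span_induction with
    | mem x hx =>
      obtain ⟨⟨i, hi⟩, rfl⟩ := hx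
      change inner ℂ (lanczosVec A u i) _ = 0
      rw [hv i (by omega), inner_smul_left, inner_polyVec hA, mul_comm (orthoPoly L i),
        ← hL, map_orthoPoly_mul_orthoPoly (j + 1) (fun l hl => (h l (by omega)).ne') i hi]
      simp
    | zero => simp
    | add x y _ _ hx hy => rw [inner_add_left, hx, hy, add_zero]
    | smul a x _ hx => rw [inner_smul_left, hx, mul_zero]
  obtain ⟨R, hR, hX⟩ := exists_X_mul_orthoPoly (L := L) j
  have hRm : polyVec A u R ∈ lanczosSpace A u j := by
    rcases hR with ⟨-, rfl⟩ | ⟨l, rfl, rfl⟩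
    · simp
    · rw [polyVec_C_mul]; exact Submodule.smul_mem _ _ (hmem l (by omega))
  rw [hv j le_rfl, map_smul, map_smul, toEuclideanCLM_polyVec, hX, map_add, map_add, map_add,
    map_add, Submodule.starProjection_eq_self_iff.2 horth,
    (Submodule.starProjection_apply_eq_zero_iff _).2,
    (Submodule.starProjection_apply_eq_zero_iff _).2, add_zero, add_zero]
  · rw [Submodule.orthogonal_orthogonal]; exact hRm
  · rw [Submodule.orthogonal_orthogonal, polyVec_C_mul]
    exact Submodule.smul_mem _ _ (hmem j le_rfl)

/-- The Lanczos vectors are the normalized vectors `P_j(A) u`. -/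
lemma lanczosVec_eq (hA : A.IsHermitian) (hu : ‖u‖ = 1) {k : ℕ}
    (h : ∀ i ≤ k, 0 < orthoNormSq (vecFunctional A u) i) (j : ℕ) (hj : j ≤ k) :
    lanczosVec A u j = (((√(orthoNormSq (vecFunctional A u) j))⁻¹ : ℝ) : ℂ) •
      polyVec A u (orthoPoly (vecFunctional A u) j) := by
  induction j using Nat.strong_induction_on with
  | _ j ih =>
    cases j with
    | zero =>
      have := norm_polyVec_orthoPoly (u := u) hA 0
      rw [orthoPoly_zero, polyVec_one, hu] at this
      rw [orthoPoly_zero, polyVec_one, ← this, lanczosVec]; simp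
    | succ j =>
      have hp := starProjection_lanczosSpace hA j (fun i hi => h i (by omega))
        (fun i hi => ih i (by omega) (by omega))
      have hj0 := Real.sqrt_pos.2 (h j (by omega))
      rw [lanczosVec]
      change ((‖(lanczosSpace A u j)ᗮ.starProjection (Matrix.toEuclideanCLM (𝕜 := ℂ) A
        (lanczosVec A u j))‖⁻¹ : ℝ) : ℂ) • (lanczosSpace A u j)ᗮ.starProjection
          (Matrix.toEuclideanCLM (𝕜 := ℂ) A (lanczosVec A u j)) = _
      rw [hp, norm_smul, norm_polyVec_orthoPoly hA, smul_smul, Complex.norm_real, Real.norm_eq_abs,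
        abs_of_pos (inv_pos.2 hj0), ← Complex.ofReal_mul]
      congr 2
      field_simp

lemma lanczosBeta_eq (hA : A.IsHermitian) (hu : ‖u‖ = 1) {k : ℕ}
    (h : ∀ i ≤ k, 0 < orthoNormSq (vecFunctional A u) i) (j : ℕ) (hj : j ≤ k) :
    lanczosBeta A u j = √(jacobiOffSq (vecFunctional A u) j) := by
  have hp := starProjection_lanczosSpace hA j (fun i hi => h i (by omega))
    (fun i hi => lanczosVec_eq hA hu h i (by omega))
  have hj0 := Real.sqrt_pos.2 (h j (by omega))
  rw [lanczosBeta, hp, norm_smul, norm_polyVec_orthoPoly hA, Complex.norm_real, Real.norm_eq_abs,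
    abs_of_pos (inv_pos.2 hj0), jacobiOffSq, Real.sqrt_div' _ (h j hj).le, div_eq_inv_mul]

lemma lanczosAlpha_eq (hA : A.IsHermitian) (hu : ‖u‖ = 1) {k : ℕ}
    (h : ∀ i ≤ k, 0 < orthoNormSq (vecFunctional A u) i) (j : ℕ) (hj : j ≤ k) :
    lanczosAlpha A u j = jacobiDiag (vecFunctional A u) j := by
  have hs := Real.mul_self_sqrt (h j hj).le
  rw [lanczosAlpha, lanczosVec_eq hA hu h j hj, map_smul, inner_smul_left, inner_smul_right,
    toEuclideanCLM_polyVec, inner_polyVec hA, Complex.conj_ofReal, ← Complex.ofReal_mul,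
    ← Complex.ofReal_mul, Complex.ofReal_re, jacobiDiag, mul_comm (orthoPoly _ j),
    ← mul_assoc, ← mul_inv, hs, inv_mul_eq_div]

lemma not_lanczosStopsBefore (hA : A.IsHermitian) (hu : ‖u‖ = 1) {k : ℕ}
    (h : ∀ i ≤ k, 0 < orthoNormSq (vecFunctional A u) i) : ¬ LanczosStopsBefore A u k := by
  rintro ⟨j, hj, h0⟩
  rw [lanczosBeta_eq hA hu h j (by omega)] at h0
  exact (Real.sqrt_pos.2 (div_pos (h (j + 1) (by omega)) (h j (by omega)))).ne' h0

/-- The tridiagonal array of Jacobi coefficients of a functional. -/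
noncomputable def jacobiEntry (L : ℝ[X] →ₗ[ℝ] ℝ) (i j : ℕ) : ℝ :=
  if i = j then jacobiDiag L i
  else if i + 1 = j then √(jacobiOffSq L i)
  else if j + 1 = i then √(jacobiOffSq L j)
  else 0

lemma lanczosJacobi_eq (hA : A.IsHermitian) (hu : ‖u‖ = 1) {k : ℕ}
    (h : ∀ i ≤ k, 0 < orthoNormSq (vecFunctional A u) i) (i j : Fin k) :
    lanczosJacobi A u k i j = jacobiEntry (vecFunctional A u) i j := by
  rw [lanczosJacobi, Matrix.of_apply, jacobiEntry, lanczosAlpha_eq hA hu h i i.2.le,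
    lanczosBeta_eq hA hu h i i.2.le, lanczosBeta_eq hA hu h j j.2.le]
  simp only [Fin.ext_iff]

end LanczosOrtho

/-- Entrywise form of `IsBddPos.jacobi_stable`. -/
theorem IsBddPos.jacobiEntry_stable {L L' : ℝ[X] →ₗ[ℝ] ℝ} {M : ℝ} (hL : IsBddPos L M)
    (hL' : IsBddPos L' M) (hM : 1 ≤ M) {k : ℕ} {δ κ ε : ℝ}
    (hκ : ∀ p : ℝ[X], p.Monic → p.natDegree ≤ k → κ ≤ L' (p * p)) (hκ0 : 0 < κ)
    (hδ : ∀ m ≤ 2 * k + 1, |L (X ^ m) - L' (X ^ m)| ≤ δ) (hε0 : 0 ≤ ε) (hε : ε ≤ 1)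
    (hs : 6 * M ^ (k + 1) * √(δ * (1 + 2 * M) ^ (2 * k + 1)) ≤ ε * κ) :
    (∀ j ≤ k, 0 < orthoNormSq L j) ∧
      ∀ i < k, ∀ j < k, |jacobiEntry L i j - jacobiEntry L' i j| ≤ ε := by
  obtain ⟨h1, h2, h3⟩ := hL.jacobi_stable hL' hM hκ hκ0 hδ hε hs
  refine ⟨h1, fun i hi j hj => ?_⟩
  unfold jacobiEntry
  split_ifs
  · exact h2 i hi.le
  · exact h3 i hi
  · exact h3 j hj
  · simpa using hε0

/-! ### Quadratic forms on the sphere -/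

section Sphere

/-- The action of a linear isometry on the unit sphere. -/
noncomputable def sphereIsometry {n : ℕ}
    (g : EuclideanSpace ℝ (Fin n) ≃ₗᵢ[ℝ] EuclideanSpace ℝ (Fin n))
    (u : Metric.sphere (0 : EuclideanSpace ℝ (Fin n)) 1) :
    Metric.sphere (0 : EuclideanSpace ℝ (Fin n)) 1 :=
  ⟨g u.1, by rw [mem_sphere_zero_iff_norm, g.norm_map]; exact norm_eq_of_mem_sphere u⟩

lemma continuous_sphereIsometry {n : ℕ}
    (g : EuclideanSpace ℝ (Fin n) ≃ₗᵢ[ℝ] EuclideanSpace ℝ (Fin n)) :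
    Continuous (sphereIsometry g) :=
  Continuous.subtype_mk (g.continuous.comp continuous_subtype_val) _

open scoped Pointwise in
lemma measurePreserving_sphereIsometry {n : ℕ}
    (g : EuclideanSpace ℝ (Fin n) ≃ₗᵢ[ℝ] EuclideanSpace ℝ (Fin n)) :
    MeasurePreserving (sphereIsometry g) (sphereUnif n) (sphereUnif n) := by
  refine MeasurePreserving.smul_measure ⟨(continuous_sphereIsometry g).measurable, ?_⟩ _
  ext s hs
  have hm := (continuous_sphereIsometry g).measurable
  rw [Measure.map_apply hm hs, Measure.toSphere_apply' _ (hm hs), Measure.toSphere_apply' _ hs]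
  congr 1
  have e : Set.Ioo (0 : ℝ) 1 • ((↑) '' (sphereIsometry g ⁻¹' s) : Set (EuclideanSpace ℝ (Fin n)))
      = g ⁻¹' (Set.Ioo (0 : ℝ) 1 • ((↑) '' s)) := by
    ext x
    simp only [Set.mem_smul, Set.mem_preimage, Set.mem_image]
    constructor
    · rintro ⟨r, hr, _, ⟨u, hu, rfl⟩, rfl⟩
      exact ⟨r, hr, _, ⟨_, hu, rfl⟩, by rw [map_smul]; rfl⟩
    · rintro ⟨r, hr, _, ⟨u, hu, rfl⟩, h⟩
      refine ⟨r, hr, _, ⟨sphereIsometry g.symm u, ?_, rfl⟩, ?_⟩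
      · have : sphereIsometry g (sphereIsometry g.symm u) = u := by
          ext1; simp [sphereIsometry]
        rwa [this]
      · apply g.injective
        rw [← h, map_smul]; simp [sphereIsometry]
  rw [e]
  exact g.measurePreserving.measure_preimage_emb g.toHomeomorph.measurableEmbedding _

lemma isProbabilityMeasure_sphereUnif {n : ℕ} (hn : 1 ≤ n) :
    IsProbabilityMeasure (sphereUnif n) := by
  have : Nonempty (Fin n) := ⟨⟨0, hn⟩⟩
  have hfin := measure_ne_top (volume : Measure (EuclideanSpace ℝ (Fin n))).toSphere Set.univ
  have hne : (volume : Measure (EuclideanSpace ℝ (Fin n))).toSphere Set.univ ≠ 0 := by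
    rw [Ne, Measure.measure_univ_eq_zero]
    exact Measure.toSphere_ne_zero _
  constructor
  rw [sphereUnif, Measure.smul_apply, smul_eq_mul, ENNReal.inv_mul_cancel hne hfin]

variable {n : ℕ}

lemma integrable_sphereUnif (hn : 1 ≤ n) {f : EuclideanSpace ℝ (Fin n) → ℝ} (hf : Continuous f) :
    Integrable (fun u : Metric.sphere (0 : EuclideanSpace ℝ (Fin n)) 1 => f u.1)
      (sphereUnif n) := by
  have := isProbabilityMeasure_sphereUnif hn
  exact (hf.comp continuous_subtype_val).integrable_of_hasCompactSupport
    (HasCompactSupport.of_compactSpace _)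

lemma integral_sphereUnif_comp (g : EuclideanSpace ℝ (Fin n) ≃ₗᵢ[ℝ] EuclideanSpace ℝ (Fin n))
    {f : EuclideanSpace ℝ (Fin n) → ℝ} (hf : Continuous f) :
    ∫ u, f (g u.1) ∂sphereUnif n = ∫ u, f u.1 ∂sphereUnif n := by
  have h := (measurePreserving_sphereIsometry g)
  conv_rhs => rw [← h.map_eq]
  have hc : Continuous fun u : Metric.sphere (0 : EuclideanSpace ℝ (Fin n)) 1 => f u.1 :=
    hf.comp continuous_subtype_val
  rw [integral_map h.measurable.aemeasurable hc.aestronglyMeasurable]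
  rfl

lemma integral_sphereUnif_swap (i j : Fin n) {f : EuclideanSpace ℝ (Fin n) → ℝ}
    (hf : Continuous f) :
    ∫ u, f (WithLp.toLp 2 fun k => u.1 (Equiv.swap i j k)) ∂sphereUnif n
      = ∫ u, f u.1 ∂sphereUnif n := by
  rw [← integral_sphereUnif_comp (LinearIsometryEquiv.piLpCongrLeft 2 ℝ ℝ (Equiv.swap i j)) hf]
  refine integral_congr_ae (ae_of_all _ fun u => ?_)
  simp only
  congr 1

/-- The fourth moments of two coordinates. With the orthogonal substitution
`(a, b) ↦ ((3 a + 4 b) / 5, (4 a - 3 b) / 5)`, the reflection in the line through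
`2 e_i + e_j`, the product `a ^ 2 b ^ 2` becomes a form that involves `a ^ 4` and `b ^ 4`, and
this determines the ratio of the moments. -/
lemma integral_fourth_moments (hn : 1 ≤ n) {i j : Fin n} (hij : i ≠ j) :
    ∫ u, u.1 i ^ 4 ∂sphereUnif n = ∫ u, u.1 j ^ 4 ∂sphereUnif n ∧
    ∫ u, u.1 i ^ 4 ∂sphereUnif n = 3 * ∫ u, u.1 i ^ 2 * u.1 j ^ 2 ∂sphereUnif n := by
  have hc : ∀ l : Fin n, Continuous fun u : EuclideanSpace ℝ (Fin n) => u l := fun l => by fun_prop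
  have h4 : ∫ u, u.1 i ^ 4 ∂sphereUnif n = ∫ u, u.1 j ^ 4 ∂sphereUnif n := by
    have := integral_sphereUnif_swap i j ((hc j).pow 4)
    simpa using this
  have h31 : ∫ u, u.1 i ^ 3 * u.1 j ∂sphereUnif n = ∫ u, u.1 i * u.1 j ^ 3 ∂sphereUnif n := by
    have := integral_sphereUnif_swap i j ((hc i).mul ((hc j).pow 3))
    simpa [mul_comm] using this
  refine ⟨h4, ?_⟩
  set v : EuclideanSpace ℝ (Fin n) :=
    (2 : ℝ) • EuclideanSpace.single i 1 + EuclideanSpace.single j 1 with hv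
  have hvi : v i = 2 := by simp [hv, hij]
  have hvj : v j = 1 := by simp [hv, hij.symm]
  have hin : ∀ x : EuclideanSpace ℝ (Fin n), inner ℝ v x = 2 * x i + x j := by
    intro x
    rw [hv, inner_add_left, inner_smul_left, EuclideanSpace.inner_single_left,
      EuclideanSpace.inner_single_left]
    simp
  have hnv : ‖v‖ ^ 2 = 5 := by
    rw [← real_inner_self_eq_norm_sq, hin, hvi, hvj]; norm_num
  have hg : ∀ (x : EuclideanSpace ℝ (Fin n)) (l : Fin n),
      (Submodule.span ℝ {v}).reflection x l = 2 * ((2 * x i + x j) / 5) * v l - x l := by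
    intro x l
    rw [Submodule.reflection_singleton_apply, hin]
    simp [hnv]; ring
  have key := integral_sphereUnif_comp (n := n) (Submodule.span ℝ {v}).reflection
    (((hc i).pow 2).mul ((hc j).pow 2))
  simp only [Pi.mul_apply, Pi.pow_apply, hg, hvi, hvj] at key
  have hI : ∀ {f : EuclideanSpace ℝ (Fin n) → ℝ} (c : ℝ), Continuous f → Integrable
      (fun u : Metric.sphere (0 : EuclideanSpace ℝ (Fin n)) 1 => c * f u.1) (sphereUnif n) :=
    fun c hf => (integrable_sphereUnif hn hf).const_mul c
  have I1 := hI (f := fun u => u i ^ 4) (144 / 625) (by fun_prop)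
  have I2 := hI (f := fun u => u j ^ 4) (144 / 625) (by fun_prop)
  have I3 := hI (f := fun u => u i ^ 2 * u j ^ 2) (239 / 625) (by fun_prop)
  have I4 := hI (f := fun u => u i ^ 3 * u j) (168 / 625) (by fun_prop)
  have I5 := hI (f := fun u => u i * u j ^ 3) (168 / 625) (by fun_prop)
  have e : ∀ u : Metric.sphere (0 : EuclideanSpace ℝ (Fin n)) 1,
      (2 * ((2 * u.1 i + u.1 j) / 5) * 2 - u.1 i) ^ 2 *
        (2 * ((2 * u.1 i + u.1 j) / 5) * 1 - u.1 j) ^ 2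
      = ((144 / 625 * u.1 i ^ 4 + 144 / 625 * u.1 j ^ 4) - 239 / 625 * (u.1 i ^ 2 * u.1 j ^ 2))
        + (168 / 625 * (u.1 i ^ 3 * u.1 j) - 168 / 625 * (u.1 i * u.1 j ^ 3)) := by
    intro u; ring
  simp only [e] at key
  have key2 := integral_add ((I1.add I2).sub I3) (I4.sub I5)
  have key3 := integral_sub (I1.add I2) I3
  have key4 := integral_add I1 I2
  have key5 := integral_sub I4 I5
  simp only [Pi.add_apply, Pi.sub_apply] at key2 key3
  rw [key2, key3, key4, key5, integral_const_mul, integral_const_mul, integral_const_mul,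
    integral_const_mul, integral_const_mul] at key
  linarith

/-- The second moment of a diagonal quadratic form on the sphere. -/
lemma integral_sq_sum_mul_sq (hn : 1 ≤ n) (t : Fin n → ℝ) :
    ∫ u, (∑ i, t i * u.1 i ^ 2) ^ 2 ∂sphereUnif n
      = ((∑ i, t i) ^ 2 + 2 * ∑ i, t i ^ 2) / (n * (n + 2)) := by
  have := isProbabilityMeasure_sphereUnif hn
  have hc : ∀ l : Fin n, Continuous fun u : EuclideanSpace ℝ (Fin n) => u l := fun l => by fun_prop
  have hn' : (0 : ℝ) < n := by exact_mod_cast hn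
  obtain ⟨a, ha⟩ : ∃ a : ℝ, ∀ i j : Fin n, ∫ u, u.1 i ^ 2 * u.1 j ^ 2 ∂sphereUnif n
      = a * (1 + 2 * if i = j then 1 else 0) := by
    refine ⟨(∫ u, u.1 ⟨0, hn⟩ ^ 4 ∂sphereUnif n) / 3, fun i j => ?_⟩
    have h0 : ∫ u, u.1 ⟨0, hn⟩ ^ 4 ∂sphereUnif n = ∫ u, u.1 i ^ 4 ∂sphereUnif n := by
      rcases eq_or_ne ⟨0, hn⟩ i with h | h
      · rw [h]
      · exact (integral_fourth_moments hn h).1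
    rw [h0]
    split_ifs with h
    · subst h
      have : ∀ x : ℝ, x ^ 2 * x ^ 2 = x ^ 4 := fun x => by ring
      simp only [this]; ring
    · rw [(integral_fourth_moments hn h).2]; ring
  have main : ∀ t : Fin n → ℝ, ∫ u, (∑ i, t i * u.1 i ^ 2) ^ 2 ∂sphereUnif n
      = a * ((∑ i, t i) ^ 2 + 2 * ∑ i, t i ^ 2) := by
    intro t
    have e : ∀ u : Metric.sphere (0 : EuclideanSpace ℝ (Fin n)) 1,
        (∑ i, t i * u.1 i ^ 2) ^ 2 = ∑ i, ∑ j, t i * t j * (u.1 i ^ 2 * u.1 j ^ 2) := by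
      intro u
      rw [sq, Finset.sum_mul_sum]
      exact Finset.sum_congr rfl fun i _ => Finset.sum_congr rfl fun j _ => by ring
    have I : ∀ i j, Integrable (fun u : Metric.sphere (0 : EuclideanSpace ℝ (Fin n)) 1 =>
        t i * t j * (u.1 i ^ 2 * u.1 j ^ 2)) (sphereUnif n) := fun i j =>
      (integrable_sphereUnif hn (((hc i).pow 2).mul ((hc j).pow 2))).const_mul _
    simp only [e]
    rw [integral_finsetSum _ fun i _ => integrable_finsetSum _ fun j _ => I i j]
    have : ∀ i, ∫ u, ∑ j, t i * t j * (u.1 i ^ 2 * u.1 j ^ 2) ∂sphereUnif n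
        = ∑ j, (a * (t i * t j) + if i = j then 2 * a * (t i * t j) else 0) := by
      intro i
      rw [integral_finsetSum _ fun j _ => I i j]
      refine Finset.sum_congr rfl fun j _ => ?_
      rw [integral_const_mul, ha]
      split_ifs <;> ring
    simp only [this, Finset.sum_add_distrib, Finset.sum_ite_eq, Finset.mem_univ, if_true]
    rw [sq, Finset.sum_mul_sum, mul_add, Finset.mul_sum, Finset.mul_sum, Finset.mul_sum]
    congr 1
    · exact Finset.sum_congr rfl fun i _ => by rw [Finset.mul_sum]
    · exact Finset.sum_congr rfl fun i _ => by ring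
  -- the total mass fixes the constant
  have h1 := main fun _ => 1
  have h2 : ∀ u : Metric.sphere (0 : EuclideanSpace ℝ (Fin n)) 1, ∑ i, u.1 i ^ 2 = 1 := by
    intro u
    have := EuclideanSpace.real_norm_sq_eq u.1
    rw [norm_eq_of_mem_sphere u] at this
    linarith
  simp only [one_mul, h2, one_pow] at h1
  simp at h1
  rw [main t, eq_div_iff (by positivity)]
  linear_combination (-((∑ i, t i) ^ 2 + 2 * ∑ i, t i ^ 2)) * h1

/-- Concentration of a quadratic form on the sphere about the normalized trace. -/
theorem sphereUnif_quadratic_deviation (hn : 1 ≤ n) {S : Matrix (Fin n) (Fin n) ℝ}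
    (hS : S.IsHermitian) {K : ℝ}
    (hK : ∀ w : EuclideanSpace ℝ (Fin n), ‖w‖ = 1 →
      |inner ℝ w (Matrix.toEuclideanCLM (𝕜 := ℝ) S w)| ≤ K) {δ : ℝ} (hδ : 0 < δ) :
    sphereUnif n {u | δ ≤ |inner ℝ u.1 (Matrix.toEuclideanCLM (𝕜 := ℝ) S u.1) - S.trace / n|}
      ≤ ENNReal.ofReal (8 * K ^ 2 / (n * δ ^ 2)) := by
  have := isProbabilityMeasure_sphereUnif hn
  have hn' : (0 : ℝ) < n := by exact_mod_cast hn
  set b := hS.eigenvectorBasis with hb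
  set s := hS.eigenvalues with hs
  have heig : ∀ i, Matrix.toEuclideanCLM (𝕜 := ℝ) S (b i) = s i • b i := by
    intro i
    have := hS.mulVec_eigenvectorBasis i
    exact WithLp.ofLp_injective 2 this
  have htr : S.trace = ∑ i, s i := by simpa using hS.trace_eq_sum_eigenvalues
  have hsK : ∀ i, |s i| ≤ K := by
    intro i
    have h := hK (b i) (b.orthonormal.1 i)
    rwa [heig, inner_smul_right, real_inner_self_eq_norm_sq, b.orthonormal.1 i, one_pow,
      mul_one] at h
  have hquad : ∀ u : EuclideanSpace ℝ (Fin n), inner ℝ u (Matrix.toEuclideanCLM (𝕜 := ℝ) S u)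
      = ∑ i, s i * (b.repr u i) ^ 2 := by
    intro u
    conv_lhs => rw [← b.sum_repr u]
    rw [map_sum, sum_inner]
    refine Finset.sum_congr rfl fun i _ => ?_
    rw [inner_sum, Finset.sum_eq_single i]
    · rw [map_smul, heig, inner_smul_left, inner_smul_right, inner_smul_right,
        real_inner_self_eq_norm_sq, b.orthonormal.1 i]
      simp; ring
    · intro j _ hj
      rw [map_smul, heig, inner_smul_left, inner_smul_right, inner_smul_right,
        b.orthonormal.2 hj.symm]; simp
    · simp
  set t : Fin n → ℝ := fun i => s i - S.trace / n with ht
  have htsum : ∑ i, t i = 0 := by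
    simp only [ht, Finset.sum_sub_distrib, Finset.sum_const, Finset.card_univ, Fintype.card_fin,
      nsmul_eq_mul, ← htr]
    field_simp; ring
  have hmean : |S.trace / n| ≤ K := by
    rw [abs_div, Nat.abs_cast, div_le_iff₀ hn', htr]
    refine (Finset.abs_sum_le_sum_abs _ _).trans ((Finset.sum_le_sum fun i _ => hsK i).trans ?_)
    simp [mul_comm]
  have ht2 : ∑ i, t i ^ 2 ≤ n * (4 * K ^ 2) := by
    have : ∀ i, t i ^ 2 ≤ 4 * K ^ 2 := by
      intro i
      have h1 : |t i| ≤ 2 * K := (abs_sub _ _).trans (by linarith [hsK i])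
      have h2 := sq_le_sq' (abs_le.1 h1).1 (abs_le.1 h1).2
      nlinarith
    refine (Finset.sum_le_sum fun i _ => this i).trans ?_
    simp
  have hdev : ∀ u : Metric.sphere (0 : EuclideanSpace ℝ (Fin n)) 1,
      inner ℝ u.1 (Matrix.toEuclideanCLM (𝕜 := ℝ) S u.1) - S.trace / n
        = ∑ i, t i * (b.repr u.1 i) ^ 2 := by
    intro u
    have h1 : ∑ i, (b.repr u.1 i) ^ 2 = 1 := by
      have := EuclideanSpace.real_norm_sq_eq (b.repr u.1)
      rw [b.repr.norm_map, norm_eq_of_mem_sphere u] at this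
      linarith
    simp only [ht, sub_mul, Finset.sum_sub_distrib, ← Finset.mul_sum, h1, hquad, mul_one]
  have hcont : Continuous fun u : EuclideanSpace ℝ (Fin n) => (∑ i, t i * u i ^ 2) ^ 2 := by
    fun_prop
  have hint : ∫ u, (∑ i, t i * (b.repr u.1 i) ^ 2) ^ 2 ∂sphereUnif n ≤ 8 * K ^ 2 / n := by
    rw [integral_sphereUnif_comp b.repr hcont, integral_sq_sum_mul_sq hn, htsum,
      div_le_div_iff₀ (by positivity) hn']
    nlinarith [mul_nonneg hn'.le (sq_nonneg K), mul_nonneg (mul_nonneg hn'.le hn'.le) (sq_nonneg K),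
      mul_le_mul_of_nonneg_right ht2 hn'.le]
  have hmarkov := mul_meas_ge_le_integral_of_nonneg (μ := sphereUnif n)
    (f := fun u => (∑ i, t i * (b.repr u.1 i) ^ 2) ^ 2) (ae_of_all _ fun u => sq_nonneg _)
    (integrable_sphereUnif hn (hcont.comp b.repr.continuous)) (δ ^ 2)
  have hset : {u : Metric.sphere (0 : EuclideanSpace ℝ (Fin n)) 1 |
      δ ≤ |inner ℝ u.1 (Matrix.toEuclideanCLM (𝕜 := ℝ) S u.1) - S.trace / n|}
      = {u | δ ^ 2 ≤ (∑ i, t i * (b.repr u.1 i) ^ 2) ^ 2} := by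
    ext u
    rw [Set.mem_ofPred_eq, Set.mem_ofPred_eq, hdev, ← abs_of_pos hδ, ← sq_le_sq, abs_of_pos hδ]
  rw [hset, ← ofReal_measureReal]
  refine ENNReal.ofReal_le_ofReal ?_
  rw [← div_div, le_div_iff₀ (by positivity), mul_comm]
  exact hmarkov.trans hint

end Sphere

/-! ### Kolmogorov distance and sets with few components -/

section Kolmogorov

variable {μ ν : Measure ℝ} [IsProbabilityMeasure μ] [IsProbabilityMeasure ν] {K : ℝ}

lemma abs_measureReal_Iic_sub_le_kolmogorovDist (t : ℝ) :
    |μ.real (Set.Iic t) - ν.real (Set.Iic t)| ≤ kolmogorovDist μ ν := by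
  refine le_ciSup (f := fun t => |μ.real (Set.Iic t) - ν.real (Set.Iic t)|) ⟨1, ?_⟩ t
  rintro _ ⟨s, rfl⟩
  simp only
  rw [abs_le]
  have h1 := measureReal_nonneg (μ := μ) (s := Set.Iic s)
  have h2 := measureReal_nonneg (μ := ν) (s := Set.Iic s)
  have h3 := measureReal_le_one (μ := μ) (s := Set.Iic s)
  have h4 := measureReal_le_one (μ := ν) (s := Set.Iic s)
  constructor <;> linarith

lemma abs_measureReal_Iio_sub_le (hK : ∀ t, |μ.real (Set.Iic t) - ν.real (Set.Iic t)| ≤ K)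
    (t : ℝ) : |μ.real (Set.Iio t) - ν.real (Set.Iio t)| ≤ K := by
  obtain ⟨u, hu, hut, hlim⟩ := exists_seq_strictMono_tendsto t
  have hU : Set.Iio t = ⋃ n, Set.Iic (u n) := by
    ext x
    simp only [Set.mem_Iio, Set.mem_iUnion, Set.mem_Iic]
    constructor
    · intro hx
      obtain ⟨n, hn⟩ := (hlim.eventually (lt_mem_nhds hx)).exists
      exact ⟨n, hn.le⟩
    · rintro ⟨n, hn⟩
      exact hn.trans_lt (hut n)
  have hmono : Monotone fun n => Set.Iic (u n) := fun a b hab =>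
    Set.Iic_subset_Iic.2 (hu.monotone hab)
  have h : ∀ (ρ : Measure ℝ) [IsProbabilityMeasure ρ],
      Tendsto (fun n => ρ.real (Set.Iic (u n))) atTop (𝓝 (ρ.real (Set.Iio t))) := by
    intro ρ _
    rw [hU]
    exact (ENNReal.tendsto_toReal (measure_ne_top _ _)).comp (tendsto_measure_iUnion_atTop hmono)
  exact le_of_tendsto ((h μ).sub (h ν)).abs (Eventually.of_forall fun n => hK _)

/-- Two measures at Kolmogorov distance `K` differ by `O((m + 1) K)` on a set whose
indicator function is constant on each interval avoiding some `m` points. -/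
lemma abs_measureReal_sub_le_of_switch (hK : ∀ t, |μ.real (Set.Iic t) - ν.real (Set.Iic t)| ≤ K)
    {S : Set ℝ} (hS : MeasurableSet S) (F : Finset ℝ)
    (hF : ∀ a b, a < b → (∀ x ∈ F, x ∉ Set.Icc a b) → (a ∈ S ↔ b ∈ S)) :
    |μ.real S - ν.real S| ≤ (4 * F.card + 2) * K := by
  have hK0 : 0 ≤ K := (abs_nonneg _).trans (hK 0)
  have hIio := abs_measureReal_Iio_sub_le hK
  -- a set on which membership in `S` is constant meets `S` in everything or nothing
  have hconst : ∀ T : Set ℝ, (∀ a ∈ T, ∀ b ∈ T, a < b → (a ∈ S ↔ b ∈ S)) →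
      S ∩ T = ∅ ∨ S ∩ T = T := by
    intro T hT
    rcases Set.eq_empty_or_nonempty (S ∩ T) with h | ⟨x, hxS, hxT⟩
    · exact Or.inl h
    · refine Or.inr (Set.inter_eq_right.2 fun y hy => ?_)
      rcases lt_trichotomy x y with h | h | h
      · exact (hT x hxT y hy h).1 hxS
      · exact h ▸ hxS
      · exact (hT y hy x hxT h).2 hxS
  have hdiff : ∀ (T : Set ℝ) (c : ℝ), 0 ≤ c → |μ.real T - ν.real T| ≤ c →
      (S ∩ T = ∅ ∨ S ∩ T = T) → |μ.real (S ∩ T) - ν.real (S ∩ T)| ≤ c := by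
    rintro T c hc h (h' | h') <;> rw [h']
    · simpa using hc
    · exact h
  have key : ∀ (m : ℕ) (b : ℝ), (F.filter (· < b)).card ≤ m →
      |μ.real (S ∩ Set.Iio b) - ν.real (S ∩ Set.Iio b)| ≤ (4 * m + 1) * K := by
    intro m
    induction m with
    | zero =>
      intro b hb
      have hb' : ∀ x ∈ F, ¬ x < b := by
        have := Finset.card_eq_zero.1 (Nat.le_zero.1 hb)
        exact fun x hx => Finset.filter_eq_empty_iff.1 this hx
      refine hdiff _ _ (by simpa using hK0) (by simpa using hIio b) (hconst _ ?_)
      intro a _ c hc hac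
      exact hF a c hac fun x hx hxm => hb' x hx (hxm.2.trans_lt hc)
    | succ m ih =>
      intro b hb
      by_cases hne : (F.filter (· < b)).Nonempty
      · set r := (F.filter (· < b)).max' hne with hr
        have hrm := Finset.mem_filter.1 ((F.filter (· < b)).max'_mem hne)
        have hrb : r < b := hrm.2
        have hcard : (F.filter (· < r)).card ≤ m := by
          have hlt : (F.filter (· < r)).card < (F.filter (· < b)).card := by
            refine Finset.card_lt_card (Finset.ssubset_iff_of_subset ?_ |>.2
              ⟨r, (F.filter (· < b)).max'_mem hne, by simp⟩)
            intro x hx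
            rw [Finset.mem_filter] at hx ⊢
            exact ⟨hx.1, hx.2.trans hrb⟩
          omega
        have hsplit : ∀ (ρ : Measure ℝ) [IsProbabilityMeasure ρ], ρ.real (S ∩ Set.Iio b)
            = ρ.real (S ∩ Set.Iio r) + ρ.real (S ∩ {r}) + ρ.real (S ∩ Set.Ioo r b) := by
          intro ρ _
          rw [← measureReal_union (by
              rw [Set.disjoint_left]; rintro x ⟨_, h1⟩ ⟨_, h2⟩; exact (h1.ne h2))
              (hS.inter (measurableSet_singleton r)),
            ← measureReal_union (by
              rw [Set.disjoint_left]
              rintro x (⟨_, h1⟩ | ⟨_, h1⟩) ⟨_, h2⟩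
              · exact lt_asymm h1 h2.1
              · exact h2.1.ne' h1) (hS.inter measurableSet_Ioo),
            ← Set.inter_union_distrib_left, ← Set.inter_union_distrib_left]
          congr 2
          ext x
          simp only [Set.mem_Iio, Set.mem_union, Set.mem_singleton_iff, Set.mem_Ioo]
          constructor
          · intro h
            rcases lt_trichotomy x r with h' | h' | h'
            · exact Or.inl (Or.inl h')
            · exact Or.inl (Or.inr h')
            · exact Or.inr ⟨h', h⟩
          · rintro ((h | h) | h)
            · exact h.trans hrb
            · exact h ▸ hrb
            · exact h.2
        have hsing : ∀ (ρ : Measure ℝ) [IsProbabilityMeasure ρ],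
            ρ.real {r} = ρ.real (Set.Iic r) - ρ.real (Set.Iio r) := by
          intro ρ _
          rw [← measureReal_sdiff Set.Iio_subset_Iic_self measurableSet_Iio, Set.Iic_sdiff_Iio_same]
        have hIoo : ∀ (ρ : Measure ℝ) [IsProbabilityMeasure ρ],
            ρ.real (Set.Ioo r b) = ρ.real (Set.Iio b) - ρ.real (Set.Iic r) := by
          intro ρ _
          rw [← measureReal_sdiff (Set.Iic_subset_Iio.2 hrb) measurableSet_Iic]
          congr 1
          ext x; simp [and_comm]
        have h1 := ih r hcard
        have h2 : |μ.real (S ∩ {r}) - ν.real (S ∩ {r})| ≤ 2 * K := by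
          refine hdiff _ _ (by linarith) ?_ (hconst _ ?_)
          · rw [hsing, hsing]
            have := hK r; have := hIio r
            rw [abs_le] at *
            constructor <;> linarith
          · rintro a rfl c rfl h
            exact (lt_irrefl _ h).elim
        have h3 : |μ.real (S ∩ Set.Ioo r b) - ν.real (S ∩ Set.Ioo r b)| ≤ 2 * K := by
          refine hdiff _ _ (by linarith) ?_ (hconst _ ?_)
          · rw [hIoo, hIoo]
            have := hK r; have := hIio b
            rw [abs_le] at *
            constructor <;> linarith
          · intro a ha c hc hac
            refine hF a c hac fun x hx hxm => ?_
            have : x ≤ r := (F.filter (· < b)).le_max' x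
              (Finset.mem_filter.2 ⟨hx, hxm.2.trans_lt hc.2⟩)
            exact absurd (ha.1.trans_le hxm.1) this.not_gt
        rw [hsplit μ, hsplit ν]
        push_cast
        rw [abs_le] at *
        constructor <;> linarith
      · rw [Finset.not_nonempty_iff_eq_empty] at hne
        refine (ih b (by rw [hne]; simp)).trans ?_
        push_cast
        nlinarith
  obtain ⟨b, hb⟩ : ∃ b, ∀ x ∈ F, x < b := by
    obtain ⟨b, hb⟩ := F.bddAbove
    exact ⟨b + 1, fun x hx => (hb hx).trans_lt (lt_add_one b)⟩
  have h1 := key _ b (Finset.card_filter_le F (· < b))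
  have h2 : |μ.real (S ∩ Set.Ici b) - ν.real (S ∩ Set.Ici b)| ≤ K := by
    refine hdiff _ _ hK0 ?_ (hconst _ ?_)
    · rw [← Set.compl_Iio, probReal_compl_eq_one_sub measurableSet_Iio,
        probReal_compl_eq_one_sub measurableSet_Iio]
      have := hIio b
      rw [abs_le] at *
      constructor <;> linarith
    · intro a ha c _ hac
      exact hF a c hac fun x hx hxm => absurd (hb x hx) (ha.trans hxm.1).not_gt
  have hsplit : ∀ (ρ : Measure ℝ) [IsProbabilityMeasure ρ], ρ.real S
      = ρ.real (S ∩ Set.Iio b) + ρ.real (S ∩ Set.Ici b) := by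
    intro ρ _
    rw [← measureReal_inter_add_sdiff (s := S) (measurableSet_Iio (a := b)), ← Set.compl_Iio,
      Set.sdiff_eq]
  rw [hsplit μ, hsplit ν]
  rw [abs_le] at *
  constructor <;> linarith

/-- A polynomial changes sign only at its roots. -/
lemma abs_measureReal_sublevel_sub_le
    (hK : ∀ t, |μ.real (Set.Iic t) - ν.real (Set.Iic t)| ≤ K) {q : ℝ[X]} (hq : q ≠ 0) :
    |μ.real {x | q.eval x ≤ 0} - ν.real {x | q.eval x ≤ 0}| ≤ (4 * q.natDegree + 2) * K := by
  have hK0 : 0 ≤ K := (abs_nonneg _).trans (hK 0)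
  refine (abs_measureReal_sub_le_of_switch hK
    (measurableSet_le q.continuous.measurable measurable_const) q.roots.toFinset ?_).trans ?_
  · intro a b hab hroot
    have hne : ∀ x ∈ Set.Icc a b, q.eval x ≠ 0 := fun x hx h0 =>
      hroot x (by rw [Multiset.mem_toFinset, mem_roots hq]; exact h0) hx
    rw [Set.mem_ofPred_eq, Set.mem_ofPred_eq]
    constructor
    · intro ha
      by_contra! hb
      obtain ⟨x, hx, h0⟩ := intermediate_value_Icc hab.le q.continuous.continuousOn ⟨ha, hb.le⟩
      exact hne x hx h0
    · intro hb
      by_contra! ha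
      obtain ⟨x, hx, h0⟩ := intermediate_value_Icc' hab.le q.continuous.continuousOn ⟨hb, ha.le⟩
      exact hne x hx h0
  · refine mul_le_mul_of_nonneg_right ?_ hK0
    have : q.roots.toFinset.card ≤ q.natDegree :=
      (Multiset.toFinset_card_le _).trans q.card_roots'
    have : (q.roots.toFinset.card : ℝ) ≤ q.natDegree := by exact_mod_cast this
    linarith

end Kolmogorov

/-! ### Sublevel sets of monic polynomials -/

section Sublevel

/-- A real monic polynomial is bounded below by the product of the distances to the real parts of
its complex roots. -/
lemma exists_prod_abs_sub_le_abs_eval {p : ℝ[X]} (hp : p.Monic) :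
    ∃ s : Multiset ℝ, s.card = p.natDegree ∧
      ∀ x : ℝ, (s.map fun a => |x - a|).prod ≤ |p.eval x| := by
  set P := p.map (algebraMap ℝ ℂ) with hP
  have hPm : P.Monic := hp.map _
  have hsplit : P.Splits := IsAlgClosed.splits P
  refine ⟨P.roots.map Complex.re, ?_, fun x => ?_⟩
  · rw [Multiset.card_map, ← hsplit.natDegree_eq_card_roots, hP, hp.natDegree_map]
  · have h1 : |p.eval x| = (P.roots.map fun z => ‖(x : ℂ) - z‖).prod := by
      have h2 : P.eval (x : ℂ) = ((p.eval x : ℝ) : ℂ) := by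
        rw [hP, ← Complex.coe_algebraMap, eval_map_apply]
      rw [← Real.norm_eq_abs, ← Complex.norm_real, ← h2, hsplit.eval_eq_prod_roots_of_monic hPm,
        ← normHom_apply, map_multiset_prod, Multiset.map_map]
      rfl
    rw [h1, Multiset.map_map]
    refine Multiset.prod_map_le_prod_map₀ _ _ (fun z _ => abs_nonneg _) fun z _ => ?_
    have := Complex.abs_re_le_norm ((x : ℂ) - z)
    simpa using this

/-- The positive part of `-log |x|`, the part of the logarithmic kernel that is large near `0`. -/
noncomputable def logKernel (x : ℝ) : ℝ := max 0 (-Real.log x)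

lemma logKernel_nonneg (x : ℝ) : 0 ≤ logKernel x := le_max_left _ _

lemma integrable_logKernel : Integrable logKernel := by
  have h : logKernel = (Set.Ioc (-1 : ℝ) 1).indicator fun x => -Real.log x := by
    ext x
    by_cases hx : x ∈ Set.Ioc (-1 : ℝ) 1
    · rw [Set.indicator_of_mem hx, logKernel, max_eq_right]
      rw [neg_nonneg, ← Real.log_abs]
      exact Real.log_nonpos (abs_nonneg _) (abs_le.2 ⟨hx.1.le, hx.2⟩)
    · rw [Set.indicator_of_notMem hx, logKernel, max_eq_left]
      rw [neg_nonpos, ← Real.log_abs]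
      refine Real.log_nonneg ?_
      rw [Set.mem_Ioc, not_and_or, not_lt, not_le] at hx
      rcases hx with hx | hx
      · exact (by linarith : (1 : ℝ) ≤ -x).trans (neg_le_abs x)
      · exact hx.le.trans (le_abs_self x)
  rw [h, integrable_indicator_iff measurableSet_Ioc]
  have := (intervalIntegral.intervalIntegrable_log' (a := -1) (b := 1)).neg
  rwa [intervalIntegrable_iff_integrableOn_Ioc_of_le (by norm_num)] at this

/-- Sublevel sets of monic polynomials are small: Markov's inequality for the sum of the
logarithmic kernels of the roots. -/
lemma volume_sublevel_mul_le {p : ℝ[X]} (hp : p.Monic) (hj : 1 ≤ p.natDegree) (T : ℝ) :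
    ENNReal.ofReal T * volume {x | |p.eval x| ≤ Real.exp (-T) ^ p.natDegree}
      ≤ ∫⁻ x, ENNReal.ofReal (logKernel x) := by
  classical
  obtain ⟨s, hs, hle⟩ := exists_prod_abs_sub_le_abs_eval hp
  set j := p.natDegree with hjdef
  have hj0 : (0 : ℝ) < j := by exact_mod_cast hj
  set S := {x | |p.eval x| ≤ Real.exp (-T) ^ j} with hS
  set g : ℝ → ENNReal := fun x => ∑ a : s, ENNReal.ofReal (logKernel (x - a.1)) with hg
  have hmeas : Measurable logKernel := by unfold logKernel; fun_prop
  have hgm : Measurable g := by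
    refine Finset.measurable_fun_sum _ fun a _ => ?_
    exact (hmeas.comp (measurable_id.sub_const _)).ennreal_ofReal
  have hgint : ∫⁻ x, g x = j * ∫⁻ x, ENNReal.ofReal (logKernel x) := by
    rw [lintegral_finsetSum]
    · have : ∀ a : s, ∫⁻ x, ENNReal.ofReal (logKernel (x - a.1))
          = ∫⁻ x, ENNReal.ofReal (logKernel x) := fun a =>
        lintegral_sub_right_eq_self (fun x => ENNReal.ofReal (logKernel x)) a.1
      simp only [this, Finset.sum_const, Finset.card_univ, Multiset.card_coe, hs, nsmul_eq_mul]
    · exact fun a _ => (hmeas.comp (measurable_id.sub_const _)).ennreal_ofReal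
  have hsub : S ⊆ {x | ENNReal.ofReal (j * T) ≤ g x} ∪ (s.toFinset : Set ℝ) := by
    intro x hx
    by_cases hxs : x ∈ s
    · right; simpa using hxs
    left
    have hne : ∀ a ∈ s, |x - a| ≠ 0 := by
      intro a ha h
      rw [abs_eq_zero, sub_eq_zero] at h
      exact hxs (h ▸ ha)
    have e : (s.map fun a => |x - a|).prod = ∏ a : s, |x - a.1| := by
      rw [← Multiset.map_univ s (fun a => |x - a|)]; rfl
    have hprod : 0 < ∏ a : s, |x - a.1| :=
      Finset.prod_pos fun a _ => (abs_nonneg _).lt_of_ne' (hne a.1 (Multiset.coe_mem))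
    have h1 : Real.log (∏ a : s, |x - a.1|) ≤ -(j * T) := by
      have h2 := (e ▸ hle x).trans hx
      have h3 := Real.log_le_log hprod h2
      rw [Real.log_pow, Real.log_exp] at h3
      linarith
    rw [Real.log_prod (fun a _ => hne a.1 (Multiset.coe_mem))] at h1
    have h4 : j * T ≤ ∑ a : s, logKernel (x - a.1) := by
      calc (j : ℝ) * T ≤ ∑ a : s, -Real.log |x - a.1| := by
            rw [Finset.sum_neg_distrib]; linarith
        _ ≤ _ := Finset.sum_le_sum fun a _ => by
            rw [Real.log_abs]; exact le_max_right _ _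
    refine (ENNReal.ofReal_le_ofReal h4).trans_eq ?_
    exact ENNReal.ofReal_sum_of_nonneg fun a _ => logKernel_nonneg _
  have hvol : volume S ≤ volume {x | ENNReal.ofReal (j * T) ≤ g x} := by
    refine (measure_mono hsub).trans ((measure_union_le _ _).trans ?_)
    rw [(Finset.finite_toSet _).measure_zero, add_zero]
  have hmk := mul_meas_ge_le_lintegral₀ (μ := volume) hgm.aemeasurable (ENNReal.ofReal (j * T))
  rw [hgint, ENNReal.ofReal_mul hj0.le, ENNReal.ofReal_natCast, mul_assoc] at hmk
  rw [ENNReal.ofReal_mul hj0.le, ENNReal.ofReal_natCast] at hvol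
  have hjne : (j : ENNReal) ≠ 0 := by exact_mod_cast (by omega : j ≠ 0)
  exact (mul_le_mul_right hvol _).trans
    ((ENNReal.mul_le_mul_iff_right hjne (ENNReal.natCast_ne_top j)).1 hmk)

/-- A probability measure with nonzero absolutely continuous part gives mass bounded below to the
complements of the sublevel sets `{|p| ≤ δ₀ ^ deg p}` of all monic polynomials. -/
lemma exists_le_measureReal_superlevel (μ : Measure ℝ) [IsProbabilityMeasure μ]
    (hac : (volume : Measure ℝ).withDensity (μ.rnDeriv volume) ≠ 0) :
    ∃ η δ₀ : ℝ, 0 < η ∧ 0 < δ₀ ∧ δ₀ < 1 ∧ ∀ p : ℝ[X], p.Monic → 1 ≤ p.natDegree →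
      μ.real {x | |p.eval x| ≤ δ₀ ^ p.natDegree} ≤ 1 - η := by
  set ρ := (volume : Measure ℝ).withDensity (μ.rnDeriv volume) with hρ
  have hρle : ρ ≤ μ := Measure.withDensity_rnDeriv_le μ volume
  have hρu : ρ Set.univ ≠ 0 := by rwa [Ne, Measure.measure_univ_eq_zero]
  have hρfin : ρ Set.univ ≠ ⊤ := ((hρle _).trans_lt (measure_lt_top μ _)).ne
  have hint : ∫⁻ x, μ.rnDeriv volume x ≠ ⊤ := by
    rwa [hρ, withDensity_apply _ MeasurableSet.univ, setLIntegral_univ] at hρfin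
  have hhalf : ρ Set.univ / 2 ≠ 0 := by simpa using hρu
  obtain ⟨d, hd, hsmall⟩ := exists_pos_setLIntegral_lt_of_measure_lt hint hhalf
  set I := ∫⁻ x, ENNReal.ofReal (logKernel x) with hI
  have hIfin : I ≠ ⊤ := integrable_logKernel.lintegral_lt_top.ne
  obtain ⟨N, hN⟩ := ENNReal.exists_nat_gt (ENNReal.div_ne_top hIfin hd.ne')
  have hN0 : (0 : ENNReal) < N := lt_of_le_of_lt bot_le hN
  have hN1 : (0 : ℝ) < N := by exact_mod_cast hN0
  refine ⟨(ρ Set.univ / 2).toReal, Real.exp (-N), ?_, Real.exp_pos _, ?_, fun p hp hj => ?_⟩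
  · exact ENNReal.toReal_pos hhalf (ENNReal.div_ne_top hρfin two_ne_zero)
  · rw [Real.exp_lt_one_iff]; linarith
  · set S := {x | |p.eval x| ≤ Real.exp (-N) ^ p.natDegree} with hS
    have hSm : MeasurableSet S :=
      measurableSet_le (p.continuous.measurable.abs) measurable_const
    have hv := volume_sublevel_mul_le hp hj N
    rw [ENNReal.ofReal_natCast, ← hS, ← hI] at hv
    have hvd : volume S < d := by
      by_contra! hcon
      have h1 : (N : ENNReal) * d ≤ I := (mul_le_mul_right hcon _).trans hv
      exact absurd hN (not_lt.2 ((ENNReal.le_div_iff_mul_le (Or.inl hd.ne')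
        (Or.inr hIfin)).2 h1))
    have hρS : ρ S < ρ Set.univ / 2 := by
      have := hsmall S hvd
      rwa [hρ, withDensity_apply _ hSm]
    have hρc : ρ Set.univ / 2 ≤ ρ Sᶜ := by
      by_contra! hcon
      have h1 := ENNReal.add_lt_add hρS hcon
      rw [ENNReal.add_halves, measure_add_measure_compl hSm] at h1
      exact lt_irrefl _ h1
    have hμc : (ρ Set.univ / 2).toReal ≤ μ.real Sᶜ :=
      ENNReal.toReal_mono (measure_ne_top _ _) (hρc.trans (hρle _))
    rw [probReal_compl_eq_one_sub hSm] at hμc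
    linarith

/-- Measures `ν` close to `μ` in Kolmogorov distance satisfy the lower bound of
`exists_le_measureReal_superlevel` up to a degree inversely proportional to the distance. -/
lemma le_measureReal_superlevel_of_close {μ ν : Measure ℝ} [IsProbabilityMeasure μ]
    [IsProbabilityMeasure ν] {K η r : ℝ}
    (hK : ∀ t, |μ.real (Set.Iic t) - ν.real (Set.Iic t)| ≤ K) {p : ℝ[X]} (hp : p.Monic)
    (hj : 1 ≤ p.natDegree) (hr : 0 < r) (hμ : μ.real {x | |p.eval x| ≤ r} ≤ 1 - η)
    (hη : (8 * p.natDegree + 2) * K ≤ η / 2) :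
    η / 2 ≤ ν.real {x | r ^ 2 ≤ (p * p).eval x} := by
  set q := p * p - C (r ^ 2) with hq
  have hdeg : q.natDegree = 2 * p.natDegree := by
    rw [hq, natDegree_sub_C, hp.natDegree_mul hp]; ring
  have hq0 : q ≠ 0 := by
    intro h
    rw [h, natDegree_zero] at hdeg
    omega
  have hS : {x | q.eval x ≤ 0} = {x | |p.eval x| ≤ r} := by
    ext x
    rw [Set.mem_ofPred_eq, Set.mem_ofPred_eq, hq, eval_sub, eval_mul, eval_C, ← sq, sub_nonpos,
      sq_le_sq, abs_of_pos hr]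
  have h1 := abs_measureReal_sublevel_sub_le hK hq0
  rw [hdeg, hS] at h1
  push_cast at h1
  have hSm : MeasurableSet {x | |p.eval x| ≤ r} :=
    measurableSet_le (p.continuous.measurable.abs) measurable_const
  have hsub : {x | |p.eval x| ≤ r}ᶜ ⊆ {x | r ^ 2 ≤ (p * p).eval x} := by
    intro x hx
    rw [Set.mem_compl_iff, Set.mem_ofPred_eq, not_le] at hx
    rw [Set.mem_ofPred_eq, eval_mul, ← sq, sq_le_sq, abs_of_pos hr]
    exact hx.le
  refine le_trans ?_ (measureReal_mono hsub)
  rw [probReal_compl_eq_one_sub hSm]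
  have := (abs_le.1 h1).1
  linarith

end Sublevel

/-! ### The empirical spectral distribution -/

section Empirical

variable {n : ℕ} {A : Matrix (Fin n) (Fin n) ℂ}

/-- Integration of polynomials against the empirical spectral distribution. -/
noncomputable def empFunctional (hA : A.IsHermitian) : ℝ[X] →ₗ[ℝ] ℝ :=
  (n : ℝ)⁻¹ • ∑ i, Polynomial.leval (hA.eigenvalues i)

lemma empFunctional_apply (hA : A.IsHermitian) (p : ℝ[X]) :
    empFunctional hA p = (n : ℝ)⁻¹ * ∑ i, p.eval (hA.eigenvalues i) := by
  simp [empFunctional]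

lemma isProbabilityMeasure_empiricalSpectralDist (hA : A.IsHermitian) (hn : 1 ≤ n) :
    IsProbabilityMeasure (empiricalSpectralDist hA) := by
  constructor
  rw [empiricalSpectralDist, Measure.smul_apply, Measure.finsetSum_apply]
  simp only [measure_univ, Finset.sum_const, Finset.card_univ, Fintype.card_fin, nsmul_eq_mul,
    mul_one, smul_eq_mul]
  exact ENNReal.inv_mul_cancel (by exact_mod_cast (by omega : n ≠ 0)) (ENNReal.natCast_ne_top n)

lemma integrable_empiricalSpectralDist (hA : A.IsHermitian) (hn : 1 ≤ n) {f : ℝ → ℝ} :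
    Integrable f (empiricalSpectralDist hA) := by
  refine Integrable.smul_measure ?_
    (ENNReal.inv_ne_top.2 (by exact_mod_cast (by omega : n ≠ 0)))
  rw [integrable_finsetSum_measure]
  exact fun i _ => integrable_dirac (by simp)

lemma integral_empiricalSpectralDist (hA : A.IsHermitian) (f : ℝ → ℝ) :
    ∫ x, f x ∂empiricalSpectralDist hA = (n : ℝ)⁻¹ * ∑ i, f (hA.eigenvalues i) := by
  rw [empiricalSpectralDist, integral_smul_measure, integral_finsetSum_measure
    (fun i _ => integrable_dirac (by simp))]
  simp [integral_dirac]

lemma measureReal_empiricalSpectralDist (hA : A.IsHermitian) {s : Set ℝ} (hs : MeasurableSet s) :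
    (empiricalSpectralDist hA).real s
      = (n : ℝ)⁻¹ * ∑ i, s.indicator (fun _ => (1 : ℝ)) (hA.eigenvalues i) := by
  rw [← integral_empiricalSpectralDist, integral_indicator_const _ hs, smul_eq_mul, mul_one]

lemma mul_measureReal_le_empFunctional (hA : A.IsHermitian) (hn : 1 ≤ n) (p : ℝ[X]) (r : ℝ) :
    r * (empiricalSpectralDist hA).real {x | r ≤ (p * p).eval x} ≤ empFunctional hA (p * p) := by
  rw [empFunctional_apply, ← integral_empiricalSpectralDist hA (fun x => (p * p).eval x)]
  refine mul_meas_ge_le_integral_of_nonneg (ae_of_all _ fun x => ?_)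
    (integrable_empiricalSpectralDist hA hn) r
  simp only [Pi.zero_apply, eval_mul]
  exact mul_self_nonneg _

lemma norm_toEuclideanCLM_pow_apply_le {M : ℝ} (hM : ‖Matrix.toEuclideanCLM (𝕜 := ℂ) A‖ ≤ M)
    (m : ℕ) (x : EuclideanSpace ℂ (Fin n)) :
    ‖Matrix.toEuclideanCLM (𝕜 := ℂ) (A ^ m) x‖ ≤ M ^ m * ‖x‖ := by
  have hM0 : 0 ≤ M := (norm_nonneg _).trans hM
  induction m with
  | zero => simp
  | succ m ih =>
    have h : Matrix.toEuclideanCLM (𝕜 := ℂ) (A ^ (m + 1)) x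
        = Matrix.toEuclideanCLM (𝕜 := ℂ) A (Matrix.toEuclideanCLM (𝕜 := ℂ) (A ^ m) x) := by
      rw [pow_succ', map_mul]; rfl
    rw [h]
    calc _ ≤ _ := ContinuousLinearMap.le_opNorm _ _
      _ ≤ M * (M ^ m * ‖x‖) := mul_le_mul hM ih (norm_nonneg _) hM0
      _ = _ := by ring

lemma abs_eigenvalues_le (hA : A.IsHermitian) {M : ℝ}
    (hM : ‖Matrix.toEuclideanCLM (𝕜 := ℂ) A‖ ≤ M) (i : Fin n) : |hA.eigenvalues i| ≤ M := by
  have h1 : Matrix.toEuclideanCLM (𝕜 := ℂ) A (hA.eigenvectorBasis i)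
      = hA.eigenvalues i • hA.eigenvectorBasis i :=
    WithLp.ofLp_injective 2 (hA.mulVec_eigenvectorBasis i)
  have h2 := (Matrix.toEuclideanCLM (𝕜 := ℂ) A).le_opNorm (hA.eigenvectorBasis i)
  rw [h1, norm_smul, hA.eigenvectorBasis.orthonormal.1 i, mul_one, mul_one,
    Real.norm_eq_abs] at h2
  exact h2.trans hM

lemma isBddPos_empFunctional (hA : A.IsHermitian) (hn : 1 ≤ n) {M : ℝ}
    (hM : ‖Matrix.toEuclideanCLM (𝕜 := ℂ) A‖ ≤ M) : IsBddPos (empFunctional hA) M where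
  map_one := by
    have : (n : ℝ) ≠ 0 := by exact_mod_cast (by omega : n ≠ 0)
    rw [empFunctional_apply]; simp [this]
  nonneg p := by
    rw [empFunctional_apply]
    refine mul_nonneg (by positivity) (Finset.sum_nonneg fun i _ => ?_)
    rw [eval_mul]; exact mul_self_nonneg _
  bdd p := by
    have hc : (0 : ℝ) ≤ (n : ℝ)⁻¹ := by positivity
    rw [empFunctional_apply, empFunctional_apply, mul_left_comm (M ^ 2),
      Finset.mul_sum _ _ (M ^ 2)]
    refine mul_le_mul_of_nonneg_left (Finset.sum_le_sum fun i _ => ?_) hc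
    have h := abs_eigenvalues_le hA hM i
    have h2 := sq_le_sq' (abs_le.1 h).1 (abs_le.1 h).2
    simp only [eval_mul, eval_X]
    nlinarith [mul_le_mul_of_nonneg_right h2 (mul_self_nonneg (p.eval (hA.eigenvalues i)))]

lemma trace_pow_eq_sum_eigenvalues (hA : A.IsHermitian) (m : ℕ) :
    (A ^ m).trace = ∑ i, ((hA.eigenvalues i : ℂ)) ^ m := by
  conv_lhs => rw [hA.spectral_theorem]
  rw [← map_pow, Unitary.conjStarAlgAut_apply, Matrix.trace_mul_comm, ← mul_assoc,
    Unitary.coe_star_mul_self, one_mul, Matrix.diagonal_pow, Matrix.trace_diagonal]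
  rfl

lemma empFunctional_X_pow (hA : A.IsHermitian) (m : ℕ) :
    empFunctional hA (X ^ m) = ((A ^ m).map Complex.re).trace / n := by
  have h : ((A ^ m).map Complex.re).trace = ((A ^ m).trace).re := by
    simp [Matrix.trace]
  rw [h, trace_pow_eq_sum_eigenvalues hA, empFunctional_apply, inv_mul_eq_div, Complex.re_sum]
  congr 1
  refine Finset.sum_congr rfl fun i _ => ?_
  rw [← Complex.ofReal_pow, Complex.ofReal_re, eval_pow, eval_X]

lemma norm_complexify (u : EuclideanSpace ℝ (Fin n)) : ‖complexify u‖ = ‖u‖ := by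
  simp [EuclideanSpace.norm_eq, complexify]

lemma re_inner_complexify (B : Matrix (Fin n) (Fin n) ℂ) (u : EuclideanSpace ℝ (Fin n)) :
    (inner ℂ (complexify u) (Matrix.toEuclideanCLM (𝕜 := ℂ) B (complexify u))).re
      = inner ℝ u (Matrix.toEuclideanCLM (𝕜 := ℝ) (B.map Complex.re) u) := by
  rw [PiLp.inner_apply, PiLp.inner_apply, Complex.re_sum]
  refine Finset.sum_congr rfl fun i _ => ?_
  simp [complexify, Matrix.mulVec, dotProduct, Complex.re_sum]

/-- The moments of the spectral measure at a random vector concentrate about the moments of the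
empirical spectral distribution. -/
lemma sphereUnif_moment_deviation (hA : A.IsHermitian) (hn : 1 ≤ n) {M : ℝ}
    (hM : ‖Matrix.toEuclideanCLM (𝕜 := ℂ) A‖ ≤ M) (m : ℕ) {δ : ℝ} (hδ : 0 < δ) :
    sphereUnif n {u | δ ≤ |vecFunctional A (complexify u.1) (X ^ m) - empFunctional hA (X ^ m)|}
      ≤ ENNReal.ofReal (8 * (M ^ m) ^ 2 / (n * δ ^ 2)) := by
  have hB : (A ^ m).IsHermitian := hA.pow m
  have hS : ((A ^ m).map Complex.re).IsHermitian := by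
    ext i j
    have := congrArg Complex.re (congrFun (congrFun hB.eq i) j)
    simpa using this
  have hv : ∀ u : EuclideanSpace ℝ (Fin n), vecFunctional A (complexify u) (X ^ m)
      = inner ℝ u (Matrix.toEuclideanCLM (𝕜 := ℝ) ((A ^ m).map Complex.re) u) := by
    intro u
    rw [vecFunctional_apply, map_pow, aeval_X, re_inner_complexify]
  have hK : ∀ w : EuclideanSpace ℝ (Fin n), ‖w‖ = 1 →
      |inner ℝ w (Matrix.toEuclideanCLM (𝕜 := ℝ) ((A ^ m).map Complex.re) w)| ≤ M ^ m := by
    intro w hw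
    rw [← re_inner_complexify]
    refine (Complex.abs_re_le_norm _).trans ((norm_inner_le_norm _ _).trans ?_)
    have := norm_toEuclideanCLM_pow_apply_le hM m (complexify w)
    rw [norm_complexify, hw, mul_one] at this
    rwa [norm_complexify, hw, one_mul]
  have := sphereUnif_quadratic_deviation hn hS hK hδ
  simpa only [hv, empFunctional_X_pow] using this

lemma pow_eq_sub_setIntegral_indicator {M t : ℝ} (ht : |t| ≤ M) (m : ℕ) :
    t ^ m = M ^ m - ∫ x in Set.Icc (-M) M, (Set.Iic x).indicator (fun _ => (1 : ℝ)) t *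
      (m * x ^ (m - 1)) := by
  obtain ⟨h1, h2⟩ := abs_le.1 ht
  have e : ∀ x, (Set.Iic x).indicator (fun _ => (1 : ℝ)) t * (m * x ^ (m - 1))
      = (Set.Ici t).indicator (fun x => m * x ^ (m - 1)) x := by
    intro x
    by_cases h : t ≤ x <;> simp [Set.indicator, h]
  have e2 : Set.Icc (-M) M ∩ Set.Ici t = Set.Icc t M := by
    ext x
    simp only [Set.mem_inter_iff, Set.mem_Icc, Set.mem_Ici]
    constructor
    · rintro ⟨⟨_, h⟩, h'⟩; exact ⟨h', h⟩
    · rintro ⟨h, h'⟩; exact ⟨⟨h1.trans h, h'⟩, h⟩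
  simp only [e]
  rw [setIntegral_indicator measurableSet_Ici, e2, integral_Icc_eq_integral_Ioc,
    ← intervalIntegral.integral_of_le h2,
    intervalIntegral.integral_eq_sub_of_hasDerivAt (f := fun x => x ^ m)
      (fun x _ => hasDerivAt_pow m x) (Continuous.intervalIntegrable (by fun_prop) _ _)]
  ring

lemma integrableOn_indicator_mul (M t : ℝ) (m : ℕ) :
    IntegrableOn (fun x => (Set.Iic x).indicator (fun _ => (1 : ℝ)) t * (m * x ^ (m - 1)))
      (Set.Icc (-M) M) := by
  have e : (fun x : ℝ => (Set.Iic x).indicator (fun _ => (1 : ℝ)) t * (m * x ^ (m - 1)))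
      = (Set.Ici t).indicator (fun x => m * x ^ (m - 1)) := by
    ext x
    by_cases h : t ≤ x <;> simp [Set.indicator, h]
  rw [e]
  exact (Continuous.integrableOn_Icc (by fun_prop)).indicator measurableSet_Ici

/-- The moments of the empirical spectral distribution, in terms of its distribution function
(integration by parts). -/
lemma empFunctional_X_pow_eq_sub_integral (hA : A.IsHermitian) (hn : 1 ≤ n) {M : ℝ}
    (hM : ‖Matrix.toEuclideanCLM (𝕜 := ℂ) A‖ ≤ M) (m : ℕ) :
    IntegrableOn (fun x => (empiricalSpectralDist hA).real (Set.Iic x) * (m * x ^ (m - 1)))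
      (Set.Icc (-M) M) ∧
    empFunctional hA (X ^ m) = M ^ m - ∫ x in Set.Icc (-M) M,
      (empiricalSpectralDist hA).real (Set.Iic x) * (m * x ^ (m - 1)) := by
  have hn' : (n : ℝ) ≠ 0 := by exact_mod_cast (by omega : n ≠ 0)
  have e : ∀ x, (empiricalSpectralDist hA).real (Set.Iic x) * (m * x ^ (m - 1))
      = (n : ℝ)⁻¹ * ∑ i, (Set.Iic x).indicator (fun _ => (1 : ℝ)) (hA.eigenvalues i) *
        (m * x ^ (m - 1)) := by
    intro x
    rw [measureReal_empiricalSpectralDist hA measurableSet_Iic, mul_assoc, Finset.sum_mul]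
  have hI : ∀ i ∈ Finset.univ, IntegrableOn (fun x =>
      (Set.Iic x).indicator (fun _ => (1 : ℝ)) (hA.eigenvalues i) * (m * x ^ (m - 1)))
      (Set.Icc (-M) M) := fun i _ => integrableOn_indicator_mul M _ m
  simp only [e]
  refine ⟨(integrable_finsetSum _ hI).const_mul _, ?_⟩
  rw [integral_const_mul, integral_finsetSum _ hI, empFunctional_apply]
  simp only [eval_pow, eval_X]
  rw [Finset.sum_congr rfl fun i _ =>
    pow_eq_sub_setIntegral_indicator (abs_eigenvalues_le hA hM i) m, Finset.sum_sub_distrib]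
  simp only [Finset.sum_const, Finset.card_univ, Fintype.card_fin, nsmul_eq_mul]
  rw [mul_sub, inv_mul_cancel_left₀ hn']

lemma abs_empFunctional_X_pow_sub_le {n' : ℕ} {A' : Matrix (Fin n') (Fin n') ℂ}
    (hA : A.IsHermitian) (hA' : A'.IsHermitian) (hn : 1 ≤ n) (hn' : 1 ≤ n') {M K : ℝ}
    (hM : ‖Matrix.toEuclideanCLM (𝕜 := ℂ) A‖ ≤ M) (hM' : ‖Matrix.toEuclideanCLM (𝕜 := ℂ) A'‖ ≤ M)
    (hK : ∀ t, |(empiricalSpectralDist hA).real (Set.Iic t) -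
      (empiricalSpectralDist hA').real (Set.Iic t)| ≤ K) (m : ℕ) :
    |empFunctional hA (X ^ m) - empFunctional hA' (X ^ m)| ≤ K * (m * M ^ (m - 1)) * (2 * M) := by
  have hM0 : 0 ≤ M := (norm_nonneg _).trans hM
  have hK0 : 0 ≤ K := (abs_nonneg _).trans (hK 0)
  obtain ⟨i1, h1⟩ := empFunctional_X_pow_eq_sub_integral hA hn hM m
  obtain ⟨i2, h2⟩ := empFunctional_X_pow_eq_sub_integral hA' hn' hM' m
  rw [h1, h2, sub_sub_sub_cancel_left, ← integral_sub i2 i1, ← Real.norm_eq_abs]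
  have := norm_setIntegral_le_of_norm_le_const (μ := volume) (s := Set.Icc (-M) M)
    (f := fun x => (empiricalSpectralDist hA').real (Set.Iic x) * (m * x ^ (m - 1)) -
      (empiricalSpectralDist hA).real (Set.Iic x) * (m * x ^ (m - 1)))
    (C := K * (m * M ^ (m - 1))) (by simp) ?_
  · refine this.trans_eq ?_
    rw [Real.volume_real_Icc_of_le (by linarith)]; ring
  · intro x hx
    rw [← sub_mul, norm_mul, Real.norm_eq_abs, abs_sub_comm, norm_mul, norm_pow, Real.norm_eq_abs,
      Real.norm_eq_abs, Nat.abs_cast]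
    have := hK x
    have hx' : |x| ≤ M := abs_le.2 hx
    gcongr

end Empirical

/-! ### Concentration of the Lanczos output -/

section Combination

variable {n : ℕ} {A : Matrix (Fin n) (Fin n) ℂ}

/-- The squared norms of monic polynomials in `L²` of the empirical spectral distribution are at
worst exponentially small, for degrees up to the inverse of the Kolmogorov distance. -/
lemma le_empFunctional_of_monic (hA : A.IsHermitian) (hn : 1 ≤ n) {μ : Measure ℝ}
    [IsProbabilityMeasure μ] {η δ₀ : ℝ} (hη : 0 < η) (h0 : 0 < δ₀) (h1 : δ₀ < 1)
    (hμ : ∀ p : ℝ[X], p.Monic → 1 ≤ p.natDegree →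
      μ.real {x | |p.eval x| ≤ δ₀ ^ p.natDegree} ≤ 1 - η) {k : ℕ}
    (hk : (8 * k + 2) * kolmogorovDist (empiricalSpectralDist hA) μ ≤ η / 2)
    (p : ℝ[X]) (hp : p.Monic) (hpk : p.natDegree ≤ k) :
    η / 2 * (δ₀ ^ k) ^ 2 ≤ empFunctional hA (p * p) := by
  have := isProbabilityMeasure_empiricalSpectralDist hA hn
  have hη1 : η ≤ 1 := by
    have h := hμ X monic_X (by simp)
    linarith [measureReal_nonneg.trans h]
  rcases Nat.eq_zero_or_pos p.natDegree with hd | hd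
  · have hp1 : p = 1 := hp.natDegree_eq_zero.1 hd
    have hδk : (δ₀ ^ k) ^ 2 ≤ 1 := pow_le_one₀ (by positivity) (pow_le_one₀ h0.le h1.le)
    rw [hp1, one_mul, (isBddPos_empFunctional hA hn le_rfl).map_one]
    nlinarith
  · have hKol : ∀ t, |μ.real (Set.Iic t) - (empiricalSpectralDist hA).real (Set.Iic t)|
        ≤ kolmogorovDist (empiricalSpectralDist hA) μ := fun t => by
      rw [abs_sub_comm]; exact abs_measureReal_Iic_sub_le_kolmogorovDist t
    have hK0 := (abs_nonneg _).trans (hKol 0)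
    have hle := le_measureReal_superlevel_of_close hKol hp hd (pow_pos h0 p.natDegree)
      (hμ p hp hd) (by
        refine le_trans (mul_le_mul_of_nonneg_right ?_ hK0) hk
        have : (p.natDegree : ℝ) ≤ k := by exact_mod_cast hpk
        linarith)
    refine le_trans ?_ (mul_measureReal_le_empFunctional hA hn p ((δ₀ ^ p.natDegree) ^ 2))
    rw [mul_comm]
    refine mul_le_mul (pow_le_pow_left₀ (by positivity)
      (pow_le_pow_of_le_one h0.le h1.le hpk) 2) hle (by positivity) (by positivity)

/-- The event that one of the first `2 k + 2` moments of the spectral measure at `u` deviates from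
that of the empirical spectral distribution by at least `δ`. -/
def MomentsDeviate (hA : A.IsHermitian) (u : EuclideanSpace ℂ (Fin n)) (k : ℕ) (δ : ℝ) : Prop :=
  ∃ m ∈ Finset.range (2 * k + 2), δ ≤ |vecFunctional A u (X ^ m) - empFunctional hA (X ^ m)|

lemma sphereUnif_momentsDeviate_le (hA : A.IsHermitian) (hn : 1 ≤ n) {M : ℝ} (hM1 : 1 ≤ M)
    (hM : ‖Matrix.toEuclideanCLM (𝕜 := ℂ) A‖ ≤ M) (k : ℕ) {δ : ℝ} (hδ : 0 < δ) :
    sphereUnif n {u | MomentsDeviate hA (complexify u.1) k δ}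
      ≤ ENNReal.ofReal (16 * M ^ 2 * (2 * M ^ 4) ^ k / (n * δ ^ 2)) := by
  have hn' : (0 : ℝ) < n := by exact_mod_cast hn
  have hset : {u : Metric.sphere (0 : EuclideanSpace ℝ (Fin n)) 1 |
      MomentsDeviate hA (complexify u.1) k δ} = ⋃ m ∈ Finset.range (2 * k + 2), {u |
        δ ≤ |vecFunctional A (complexify u.1) (X ^ m) - empFunctional hA (X ^ m)|} := by
    ext u; simp [MomentsDeviate]
  rw [hset]
  refine (measure_biUnion_finset_le _ _).trans ?_
  have hterm : ∀ m ∈ Finset.range (2 * k + 2), sphereUnif n {u |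
        δ ≤ |vecFunctional A (complexify u.1) (X ^ m) - empFunctional hA (X ^ m)|}
      ≤ ENNReal.ofReal (8 * (M ^ (2 * k + 1)) ^ 2 / (n * δ ^ 2)) := by
    intro m hm
    refine (sphereUnif_moment_deviation hA hn hM m hδ).trans (ENNReal.ofReal_le_ofReal ?_)
    have : M ^ m ≤ M ^ (2 * k + 1) :=
      pow_le_pow_right₀ hM1 (by have := Finset.mem_range.1 hm; omega)
    gcongr
  refine (Finset.sum_le_sum hterm).trans ?_
  rw [Finset.sum_const, Finset.card_range, ← ENNReal.ofReal_nsmul, nsmul_eq_mul]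
  refine ENNReal.ofReal_le_ofReal ?_
  rw [mul_div_assoc']
  refine div_le_div_of_nonneg_right ?_ (by positivity)
  have hk : ((k + 1 : ℕ) : ℝ) ≤ 2 ^ k := by exact_mod_cast (k.lt_two_pow_self : k < 2 ^ k)
  have e1 : (M ^ (2 * k + 1)) ^ 2 = M ^ 2 * (M ^ 4) ^ k := by
    rw [← pow_mul, ← pow_mul, ← pow_add]; congr 1; ring
  rw [e1, mul_pow]
  push_cast at hk ⊢
  have h2 : 0 ≤ M ^ 2 * (M ^ 4) ^ k := by positivity
  nlinarith [mul_le_mul_of_nonneg_right hk h2]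

/-- Unless the moments deviate, the Lanczos algorithm carries out `k` iterations, and its output
is close to the Jacobi matrix of the empirical spectral distribution. -/
lemma lanczos_of_not_momentsDeviate (hA : A.IsHermitian) (hn : 1 ≤ n) {M : ℝ} (hM1 : 1 ≤ M)
    (hM : ‖Matrix.toEuclideanCLM (𝕜 := ℂ) A‖ ≤ M) {k : ℕ} {δ κ ε : ℝ}
    (hκ : ∀ p : ℝ[X], p.Monic → p.natDegree ≤ k → κ ≤ empFunctional hA (p * p)) (hκ0 : 0 < κ)
    (hε0 : 0 ≤ ε) (hε : ε ≤ 1)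
    (hs : 6 * M ^ (k + 1) * √(δ * (1 + 2 * M) ^ (2 * k + 1)) ≤ ε * κ)
    {u : EuclideanSpace ℂ (Fin n)} (hu : ‖u‖ = 1) (hdev : ¬ MomentsDeviate hA u k δ) :
    ¬ LanczosStopsBefore A u k ∧ ∀ i j : Fin k,
      |lanczosJacobi A u k i j - jacobiEntry (empFunctional hA) i j| ≤ ε := by
  have hδ : ∀ m ≤ 2 * k + 1, |vecFunctional A u (X ^ m) - empFunctional hA (X ^ m)| ≤ δ := by
    intro m hm
    by_contra! hcon
    exact hdev ⟨m, Finset.mem_range.2 (by omega), hcon.le⟩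
  obtain ⟨h1, h2⟩ := (isBddPos_vecFunctional hA hM hu).jacobiEntry_stable
    (isBddPos_empFunctional hA hn hM) hM1 hκ hκ0 hδ hε0 hε hs
  refine ⟨not_lanczosStopsBefore hA hu h1, fun i j => ?_⟩
  rw [lanczosJacobi_eq hA hu h1]
  exact h2 i i.2 j j.2

end Combination

/-- For a sequence of matrices whose empirical spectral distributions converge in Kolmogorov
distance to a measure with nonzero absolutely continuous part, each Jacobi coefficient of the
empirical spectral distributions converges. -/
lemma exists_tendsto_jacobiEntry {A : ∀ n : ℕ, Matrix (Fin n) (Fin n) ℂ}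
    (hA : ∀ n, (A n).IsHermitian) {M : ℝ} (hM1 : 1 ≤ M)
    (hM : ∀ n, ‖Matrix.toEuclideanCLM (𝕜 := ℂ) (A n)‖ ≤ M) {μ : Measure ℝ}
    [IsProbabilityMeasure μ] {η δ₀ : ℝ} (hη : 0 < η) (h0 : 0 < δ₀) (h1 : δ₀ < 1)
    (hμ : ∀ p : ℝ[X], p.Monic → 1 ≤ p.natDegree →
      μ.real {x | |p.eval x| ≤ δ₀ ^ p.natDegree} ≤ 1 - η)
    (hKol : ∀ r : ℝ, 0 < r →
      ∀ᶠ n in atTop, kolmogorovDist (empiricalSpectralDist (hA n)) μ ≤ r) (i j : ℕ) :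
    ∃ l : ℝ, Tendsto (fun n => jacobiEntry (empFunctional (hA n)) i j) atTop (𝓝 l) := by
  refine cauchySeq_tendsto_of_complete (Metric.cauchySeq_iff.2 fun ε hε => ?_)
  set k := max i j + 1 with hk
  set ε' := min (ε / 2) 1 with hε'
  have hε'0 : 0 < ε' := by positivity
  have hM0 : 0 < M := by linarith
  set κ := η / 2 * (δ₀ ^ k) ^ 2 with hκ
  have hκ0 : 0 < κ := by positivity
  set B := (2 * k + 1 : ℕ) * M ^ (2 * k + 1) * (2 * M) with hB
  have hB0 : 0 < B := by positivity
  set δ := (ε' * κ / (6 * M ^ (k + 1))) ^ 2 / (1 + 2 * M) ^ (2 * k + 1) with hδ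
  have hδ0 : 0 < δ := by positivity
  have hs : 6 * M ^ (k + 1) * √(δ * (1 + 2 * M) ^ (2 * k + 1)) ≤ ε' * κ := by
    rw [hδ, div_mul_cancel₀ _ (by positivity), Real.sqrt_sq (by positivity)]
    exact (mul_div_cancel₀ _ (by positivity)).le
  have hev : ∀ᶠ n in atTop, 1 ≤ n ∧
      kolmogorovDist (empiricalSpectralDist (hA n)) μ ≤ δ / (2 * B) ∧
      (8 * k + 2) * kolmogorovDist (empiricalSpectralDist (hA n)) μ ≤ η / 2 := by
    filter_upwards [eventually_ge_atTop 1, hKol (δ / (2 * B)) (by positivity),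
      hKol (η / 2 / (8 * k + 2)) (by positivity)] with n hn h2 h3
    refine ⟨hn, h2, ?_⟩
    rwa [le_div_iff₀ (by positivity), mul_comm] at h3
  obtain ⟨N, hN⟩ := eventually_atTop.1 hev
  refine ⟨N, fun m hm n hn => ?_⟩
  obtain ⟨m1, m2, m3⟩ := hN m hm
  obtain ⟨n1, n2, n3⟩ := hN n hn
  have := isProbabilityMeasure_empiricalSpectralDist (hA m) m1
  have := isProbabilityMeasure_empiricalSpectralDist (hA n) n1
  have hK : ∀ t, |(empiricalSpectralDist (hA m)).real (Set.Iic t) -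
      (empiricalSpectralDist (hA n)).real (Set.Iic t)| ≤ δ / B := by
    intro t
    refine (abs_sub_le _ (μ.real (Set.Iic t)) _).trans ?_
    have a1 := (abs_measureReal_Iic_sub_le_kolmogorovDist
      (μ := empiricalSpectralDist (hA m)) (ν := μ) t).trans m2
    have a2 := (abs_measureReal_Iic_sub_le_kolmogorovDist
      (μ := empiricalSpectralDist (hA n)) (ν := μ) t).trans n2
    rw [abs_sub_comm] at a2
    have e : δ / (2 * B) + δ / (2 * B) = δ / B := by field_simp; norm_num
    linarith
  have hmom : ∀ l ≤ 2 * k + 1,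
      |empFunctional (hA m) (X ^ l) - empFunctional (hA n) (X ^ l)| ≤ δ := by
    intro l hl
    refine (abs_empFunctional_X_pow_sub_le (hA m) (hA n) m1 n1 (hM m) (hM n) hK l).trans ?_
    rw [mul_assoc]
    have : (l : ℝ) * M ^ (l - 1) * (2 * M) ≤ B := by
      have a1 : (l : ℝ) ≤ (2 * k + 1 : ℕ) := by exact_mod_cast hl
      have a2 : M ^ (l - 1) ≤ M ^ (2 * k + 1) := pow_le_pow_right₀ hM1 (by omega)
      rw [hB]
      gcongr
    calc δ / B * (l * M ^ (l - 1) * (2 * M)) ≤ δ / B * B :=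
          mul_le_mul_of_nonneg_left this (by positivity)
      _ = δ := div_mul_cancel₀ _ hB0.ne'
  have key := (isBddPos_empFunctional (hA m) m1 (hM m)).jacobiEntry_stable
    (isBddPos_empFunctional (hA n) n1 (hM n)) hM1
    (le_empFunctional_of_monic (hA n) n1 hη h0 h1 hμ n3) hκ0 hmom hε'0.le (min_le_right _ _) hs
  have := key.2 i (by omega) j (by omega)
  rw [Real.dist_eq]
  have : ε' ≤ ε / 2 := min_le_left _ _
  linarith

theorem proposition4p14
    (A : ∀ n : ℕ, Matrix (Fin n) (Fin n) ℂ) (hA : ∀ n, (A n).IsHermitian)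
    (M : ℝ) (hM : ∀ n, ‖Matrix.toEuclideanCLM (𝕜 := ℂ) (A n)‖ ≤ M)
    (μ : Measure ℝ) [IsProbabilityMeasure μ]
    (hac : (volume : Measure ℝ).withDensity (μ.rnDeriv volume) ≠ 0)
    (hKol : (fun n : ℕ => kolmogorovDist (empiricalSpectralDist (hA n)) μ)
      =O[atTop] fun n : ℕ => 1 / Real.log n) :
    ∃ c₂ : ℝ, 0 < c₂ ∧ ∃ k : ℕ → ℕ,
      (∀ n : ℕ, 1 ≤ n → c₂ * Real.log n ≤ k n ∧ 1 ≤ k n ∧ k n ≤ n) ∧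
      -- with probability tending to one, all `k n` iterations are carried out
      Tendsto (fun n : ℕ => sphereUnif n
        {u | LanczosStopsBefore (A n) (complexify u.1) (k n)}) atTop (𝓝 0) ∧
      -- all entries are simultaneously close to deterministic constants
      (∃ C : ∀ n : ℕ, Matrix (Fin (k n)) (Fin (k n)) ℝ, ∀ ε : ℝ, 0 < ε →
        Tendsto (fun n : ℕ => sphereUnif n
          {u | ∃ i j, ε ≤ |lanczosJacobi (A n) (complexify u.1) (k n) i j - C n i j|})
          atTop (𝓝 0)) ∧
      -- each fixed entry converges to a deterministic constant that does not depend on `n`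
      (∃ L : ℕ → ℕ → ℝ, ∀ i j : ℕ, ∀ ε : ℝ, 0 < ε →
        Tendsto (fun n : ℕ => sphereUnif n
          {u | ∃ (hi : i < k n) (hj : j < k n),
            ε ≤ |lanczosJacobi (A n) (complexify u.1) (k n) ⟨i, hi⟩ ⟨j, hj⟩ - L i j|})
          atTop (𝓝 0)) := by
  obtain ⟨η, δ₀, hη, h0, h1, hμ⟩ := exists_le_measureReal_superlevel μ hac
  obtain ⟨M', hM', hM1⟩ : ∃ M' : ℝ, (∀ n, ‖Matrix.toEuclideanCLM (𝕜 := ℂ) (A n)‖ ≤ M') ∧ 1 ≤ M' :=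
    ⟨max M 1, fun n => (hM n).trans (le_max_left _ _), le_max_right _ _⟩
  clear hM
  have hlog : Tendsto (fun n : ℕ => Real.log n) atTop atTop :=
    Real.tendsto_log_atTop.comp tendsto_natCast_atTop_atTop
  obtain ⟨C₀, hC₀, hKol'⟩ := hKol.exists_pos
  have hKolb : ∀ᶠ n in atTop,
      kolmogorovDist (empiricalSpectralDist (hA n)) μ ≤ C₀ / Real.log n := by
    filter_upwards [hKol'.bound, hlog.eventually_gt_atTop 0] with n hn hl
    rw [Real.norm_of_nonneg (one_div_pos.2 hl).le, mul_one_div] at hn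
    exact (Real.le_norm_self _).trans hn
  have hKol0 : ∀ r : ℝ, 0 < r →
      ∀ᶠ n in atTop, kolmogorovDist (empiricalSpectralDist (hA n)) μ ≤ r := by
    intro r hr
    filter_upwards [hKolb, hlog.eventually_ge_atTop (C₀ / r), hlog.eventually_gt_atTop 0]
      with n hn hl hl0
    exact hn.trans ((div_le_comm₀ hl0 hr).2 hl)
  set D := 1 + 2 * M' with hD
  have hD0 : 0 < D := by positivity
  have hM0 : 0 < M' := by linarith
  -- all exponentials in `k` that occur are at most `G ^ k`
  set G := max (M' * D / δ₀ ^ 2) (2 * M' ^ 4) with hG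
  have hG1 : 1 ≤ G := by
    have : 1 ≤ M' ^ 4 := one_le_pow₀ hM1
    exact le_trans (by linarith) (le_max_right _ _)
  have hlG : 0 ≤ Real.log G := Real.log_nonneg hG1
  obtain ⟨c, hc0, hc1, hcG, hcC⟩ : ∃ c : ℝ, 0 < c ∧ c ≤ 1 ∧ c * Real.log G ≤ 1 / 16 ∧
      8 * c * C₀ ≤ η / 4 := by
    refine ⟨min (min (1 / (16 * (Real.log G + 1))) (η / (32 * C₀))) 1, by positivity,
      min_le_right _ _, ?_, ?_⟩
    · refine (mul_le_mul_of_nonneg_right ((min_le_left _ _).trans (min_le_left _ _)) hlG).trans ?_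
      rw [div_mul_eq_mul_div, div_le_div_iff₀ (by positivity) (by norm_num)]
      linarith
    · have : min (min (1 / (16 * (Real.log G + 1))) (η / (32 * C₀))) 1 ≤ η / (32 * C₀) :=
        (min_le_left _ _).trans (min_le_right _ _)
      rw [le_div_iff₀ (by positivity)] at this
      linarith
  set k : ℕ → ℕ := fun n => max 1 ⌈c * Real.log n⌉₊ with hk
  have hkup : ∀ n : ℕ, 1 ≤ n → (k n : ℝ) ≤ c * Real.log n + 1 := by
    intro n hn
    have hl : 0 ≤ c * Real.log n := mul_nonneg hc0.le (Real.log_natCast_nonneg n)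
    rw [hk]
    push_cast
    exact max_le (by linarith) (Nat.ceil_lt_add_one hl).le
  -- the scale `y n = n ^ (1 / 16)`; moments are compared up to `δ n = n ^ (-1 / 4)`
  set y : ℕ → ℝ := fun n => Real.exp (Real.log n / 16) with hy
  have hy0 : ∀ n, 0 < y n := fun n => Real.exp_pos _
  have hytop : Tendsto y atTop atTop :=
    Real.tendsto_exp_atTop.comp (hlog.atTop_div_const (by norm_num))
  have hyn : ∀ n : ℕ, 1 ≤ n → (n : ℝ) = y n ^ 16 := by
    intro n hn
    rw [hy]
    simp only
    rw [← Real.exp_nat_mul, Nat.cast_ofNat, mul_div_cancel₀ _ (by norm_num),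
      Real.exp_log (by exact_mod_cast hn)]
  have hGk : ∀ n : ℕ, 1 ≤ n → G ^ k n ≤ G * y n := by
    intro n hn
    have hGpos : 0 < G := by linarith
    have e : G ^ k n = Real.exp (k n * Real.log G) := by
      rw [Real.exp_nat_mul, Real.exp_log hGpos]
    have e2 : G * y n = Real.exp (Real.log G + Real.log n / 16) := by
      rw [Real.exp_add, Real.exp_log hGpos]
    rw [e, e2, Real.exp_le_exp]
    have a1 := mul_le_mul_of_nonneg_right (hkup n hn) hlG
    have a2 := mul_le_mul_of_nonneg_right hcG (Real.log_natCast_nonneg n)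
    nlinarith
  set δ : ℕ → ℝ := fun n => (y n ^ 2)⁻¹ ^ 2 with hδ
  have hδ0 : ∀ n, 0 < δ n := fun n => by have := hy0 n; positivity
  set E : ∀ n : ℕ, Set (Metric.sphere (0 : EuclideanSpace ℝ (Fin n)) 1) := fun n =>
    {u | MomentsDeviate (hA n) (complexify u.1) (k n) (δ n)} with hE
  have hEle : ∀ᶠ n in atTop, sphereUnif n (E n) ≤ ENNReal.ofReal (16 * M' ^ 2 * G / y n) := by
    filter_upwards [eventually_ge_atTop 1, hytop.eventually_ge_atTop 1] with n hn hy1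
    refine (sphereUnif_momentsDeviate_le (hA n) hn hM1 (hM' n) (k n) (hδ0 n)).trans
      (ENNReal.ofReal_le_ofReal ?_)
    have hyp := hy0 n
    have e : (n : ℝ) * δ n ^ 2 = y n ^ 8 := by
      rw [hyn n hn, hδ]; field_simp
    have h2 : (2 * M' ^ 4) ^ k n ≤ G * y n :=
      (pow_le_pow_left₀ (by positivity) (le_max_right _ _) _).trans (hGk n hn)
    rw [e, div_le_div_iff₀ (by positivity) hyp]
    calc 16 * M' ^ 2 * (2 * M' ^ 4) ^ k n * y n ≤ 16 * M' ^ 2 * (G * y n) * y n := by gcongr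
      _ = 16 * M' ^ 2 * G * y n ^ 2 := by ring
      _ ≤ 16 * M' ^ 2 * G * y n ^ 8 := by
        gcongr
        norm_num
  have hE0 : Tendsto (fun n => sphereUnif n (E n)) atTop (𝓝 0) := by
    have hlim : Tendsto (fun n => ENNReal.ofReal (16 * M' ^ 2 * G / y n)) atTop (𝓝 0) := by
      rw [← ENNReal.ofReal_zero]
      exact ENNReal.tendsto_ofReal (hytop.const_div_atTop _)
    exact tendsto_of_tendsto_of_tendsto_of_le_of_le' tendsto_const_nhds hlim
      (Eventually.of_forall fun _ => zero_le) hEle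
  have hsub : ∀ S : ∀ n : ℕ, Set (Metric.sphere (0 : EuclideanSpace ℝ (Fin n)) 1),
      (∀ᶠ n in atTop, ∀ u ∉ E n, u ∉ S n) →
      Tendsto (fun n => sphereUnif n (S n)) atTop (𝓝 0) := by
    intro S hS
    refine tendsto_of_tendsto_of_tendsto_of_le_of_le' tendsto_const_nhds hE0
      (Eventually.of_forall fun _ => zero_le) ?_
    filter_upwards [hS] with n hn
    exact measure_mono fun u hu => by_contra fun h => hn u h hu
  have hmain : ∀ ε : ℝ, 0 < ε → ∀ᶠ n in atTop, ∀ u ∉ E n,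
      ¬ LanczosStopsBefore (A n) (complexify u.1) (k n) ∧ ∀ i j : Fin (k n),
        |lanczosJacobi (A n) (complexify u.1) (k n) i j
          - jacobiEntry (empFunctional (hA n)) i j| < ε := by
    intro ε hε
    set ε' := min (ε / 2) 1 with hε'
    have hε'0 : 0 < ε' := by positivity
    have hε'ε : ε' < ε := (min_le_left _ _).trans_lt (by linarith)
    filter_upwards [eventually_ge_atTop 1, hKolb, hlog.eventually_gt_atTop 0,
      hlog.eventually_ge_atTop (40 * C₀ / η),
      hytop.eventually_ge_atTop (6 * M' * √D * G / (ε' * (η / 2)))]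
      with n hn hKn hl0 hl1 hyl u hu
    have hyp := hy0 n
    have hKk : (8 * k n + 2) * kolmogorovDist (empiricalSpectralDist (hA n)) μ ≤ η / 2 := by
      calc _ ≤ (8 * k n + 2) * (C₀ / Real.log n) :=
            mul_le_mul_of_nonneg_left hKn (by positivity)
        _ ≤ (8 * (c * Real.log n + 1) + 2) * (C₀ / Real.log n) := by
            gcongr
            exact hkup n hn
        _ = 8 * c * C₀ + 10 * C₀ / Real.log n := by field_simp; ring
        _ ≤ η / 4 + η / 4 := by
            refine add_le_add hcC ?_
            rw [div_le_iff₀ hη] at hl1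
            rw [div_le_iff₀ hl0]
            linarith
        _ = η / 2 := by ring
    have hs : 6 * M' ^ (k n + 1) * √(δ n * D ^ (2 * k n + 1))
        ≤ ε' * (η / 2 * (δ₀ ^ k n) ^ 2) := by
      have e1 : √(δ n * D ^ (2 * k n + 1)) = (y n ^ 2)⁻¹ * (D ^ k n * √D) := by
        have e : δ n * D ^ (2 * k n + 1) = ((y n ^ 2)⁻¹ * D ^ k n) ^ 2 * D := by
          rw [hδ]; ring
        rw [e, Real.sqrt_mul (by positivity), Real.sqrt_sq (by positivity), mul_assoc]
      have h2 : (M' * D) ^ k n ≤ G * y n * (δ₀ ^ k n) ^ 2 := by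
        have h3 : (M' * D / δ₀ ^ 2) ^ k n ≤ G * y n :=
          (pow_le_pow_left₀ (by positivity) (le_max_left _ _) _).trans (hGk n hn)
        rw [div_pow, div_le_iff₀ (by positivity)] at h3
        refine h3.trans_eq ?_
        rw [← pow_mul, ← pow_mul, mul_comm 2]
      rw [div_le_iff₀ (by positivity)] at hyl
      rw [e1]
      calc 6 * M' ^ (k n + 1) * ((y n ^ 2)⁻¹ * (D ^ k n * √D))
          = 6 * M' * √D * (M' * D) ^ k n / y n ^ 2 := by
            rw [mul_pow, pow_succ]; field_simp
        _ ≤ 6 * M' * √D * (G * y n * (δ₀ ^ k n) ^ 2) / y n ^ 2 := by gcongr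
        _ = (6 * M' * √D * G) / y n * (δ₀ ^ k n) ^ 2 := by field_simp
        _ ≤ (ε' * (η / 2)) * (δ₀ ^ k n) ^ 2 := by
            refine mul_le_mul_of_nonneg_right ?_ (by positivity)
            rw [div_le_iff₀ hyp]
            linarith
        _ = _ := by ring
    have hu1 : ‖complexify u.1‖ = 1 := by
      rw [norm_complexify]; exact norm_eq_of_mem_sphere u
    obtain ⟨r1, r2⟩ := lanczos_of_not_momentsDeviate (hA n) hn hM1 (hM' n)
      (le_empFunctional_of_monic (hA n) hn hη h0 h1 hμ hKk) (by positivity) hε'0.le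
      (min_le_right _ _) hs hu1 hu
    exact ⟨r1, fun i j => (r2 i j).trans_lt hε'ε⟩
  refine ⟨c, hc0, k, fun n hn => ⟨?_, le_max_left _ _, ?_⟩, ?_, ?_, ?_⟩
  · exact (Nat.le_ceil _).trans (by exact_mod_cast le_max_right _ _)
  · refine max_le hn (Nat.ceil_le.2 ?_)
    have a1 : Real.log n ≤ n :=
      (Real.log_le_sub_one_of_pos (by exact_mod_cast hn)).trans (by linarith)
    exact (mul_le_of_le_one_left (Real.log_natCast_nonneg n) hc1).trans a1
  · refine hsub _ ?_
    filter_upwards [hmain 1 one_pos] with n hn u hu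
    exact (hn u hu).1
  · refine ⟨fun n => Matrix.of fun i j => jacobiEntry (empFunctional (hA n)) i j,
      fun ε hε => hsub _ ?_⟩
    filter_upwards [hmain ε hε] with n hn u hu
    rintro ⟨i, j, hij⟩
    exact absurd ((hn u hu).2 i j) (not_lt.2 hij)
  · choose L hL using fun i j => exists_tendsto_jacobiEntry hA hM1 hM' hη h0 h1 hμ hKol0 i j
    refine ⟨L, fun i j ε hε => hsub _ ?_⟩
    filter_upwards [hmain (ε / 2) (by positivity),
      Metric.tendsto_nhds.1 (hL i j) (ε / 2) (by positivity)] with n hn hLn u hu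
    rintro ⟨hi, hj, hij⟩
    have a1 := (hn u hu).2 ⟨i, hi⟩ ⟨j, hj⟩
    rw [Real.dist_eq] at hLn
    have a2 := abs_sub_le (lanczosJacobi (A n) (complexify u.1) (k n) ⟨i, hi⟩ ⟨j, hj⟩)
      (jacobiEntry (empFunctional (hA n)) i j) (L i j)
    simp only at a1
    linarith
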